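/- Let $M$ be a smooth $n$-manifold and $A=C^\infty(M)\otimes M_2(\mathbb C)$, with the product calculus whose 1-forms have, locally, the central basis $dx^\mu,s^1,s^2$. Here $s^1\wedge s^1=s^2\wedge s^2=\imath\,\mathrm{Vol}$, $s^1\wedge s^2=s^2\wedge s^1=0$, the $dx^\mu$ anticommute with each other and with the $s^i$, $df=\partial_\mu f\,dx^\mu+\frac{\imath}{2}[\sigma^i,f]\,s^i$, $d\,dx^\mu=0$, $ds^i=-\sigma^i\,\mathrm{Vol}$, and $dx^\mu,s^i$ are self-adjoint ($\sigma^i$ are Pauli matrices; repeated indices are summed). Let $$\mathfrak g=g_{\mu\nu}dx^\mu\otimes dx^\nu+A_{i\mu}(s^i\otimes dx^\mu+dx^\mu\otimes s^i)+h\,(s^1\otimes s^1-s^2\otimes s^2),$$ where $g_{\mu\nu}=g_{\nu\mu}$, $A_{i\mu}$ and $h$ are complex-valued smooth fields on $M$ and $h$ is nowhere zero. Let $\nabla$ be a left connection on $\Omega^1(A)$ such that the $s^i\otimes s^j$ part of $\nabla s^k$ is $\gamma^k_{ijp}\sigma^p s^i\otimes s^j$ with $$\gamma^1_{221}=\gamma^1_{212}=-\gamma^2_{211}=\imath-a,\quad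 \gamma^1_{122}=-\gamma^2_{121}=-\gamma^2_{112}=\tfrac{\imath}{2}(u+v)-a,\quad \gamma^2_{222}=\tfrac{\imath}{2}(u+v+2)-a,\quad\gamma^1_{111}=a,$$ $$\gamma^1_{112}=-\gamma^1_{222}=-\gamma^2_{111}=\gamma^2_{221}=\gamma^2_{212}=\gamma^1_{121}=c,\quad \gamma^1_{211}=c+\tfrac{u-v}{2}-\rho,\quad\gamma^2_{122}=c-\tfrac{u-v}{2}-\rho,$$ $$a=\tfrac{\imath}{8\rho}\big((v+u-2)(v-u+2\rho)+8\rho\big),\qquad c=\tfrac{u+v}{8\rho}(2-u-v),$$ for smooth functions $u,v,\rho:M\to\mathbb C$ with $\rho$ nowhere zero. Call $(\mathfrak g,\nabla)$ a *QLC solution* if $\mathfrak g$ is a quantum metric (quantum symmetric and invertible) and $\nabla$ is a torsion free, metric compatible bimodule connection whose generalised braiding satisfies $\sigma(dx^\mu\otimes s^i)=s^i\otimes dx^\mu$; call it a *$*$-QLC solution* if moreover $\mathfrak g^\dagger=\mathfrak g$ and $\nabla$ is $*$-preserving ($\nabla\circ *=\sigma\circ\dagger\circ\nabla$, with $\dagger=\mathrm{flip}(*\otimes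 *)$). (a) For a QLC solution, at each point of $M$ either (i) $A_{1\mu}=A_{2\mu}=0$, or (ii) $(v+\rho-1)A_{1\mu}=\imath(v-\rho-1)A_{2\mu}$ and $(u-1)(v-1)=-\rho^2$. If $u,v,\rho$ are constant, one of the two alternatives holds on all of $M$. Case (i) puts no restriction on $u,v,\rho$: if $A_1=A_2=0$, $h$ is locally constant, $g$ is invertible, and $\nabla$ is the direct sum of the Levi-Civita connection of $g$ on the $dx^\mu$ and of $\gamma$ on the $s^k$, then $(\mathfrak g,\nabla)$ is a QLC solution. Now let $u=1+\rho$, $v=1-\rho$, $A_2=0$, write $A_\mu:=A_{1\mu}$, and suppose that $\tilde g_{\mu\nu}=g_{\mu\nu}-\frac1hA_\mu A_\nu$ is invertible, with inverse $\tilde g^{\mu\nu}$. (b) $(\mathfrak g,\nabla)$ is a QLC solution if and only if $h$ is locally constant and, in each chart, there are smooth fields $\Gamma^\mu_{\alpha\beta}=\Gamma^\mu_{\beta\alpha}$ (with covariant derivative $\nabla_\mu$) and $C^\mu$ with $A_\mu C^\mu=0$ such that $$\nabla_\mu g_{\sigma\nu}=\frac1{2h}\big(A_\nu(\nabla_\sigma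 A_\mu+\nabla_\mu A_\sigma)+A_\sigma(\nabla_\nu A_\mu+\nabla_\mu A_\nu)\big)$$ and $$\nabla dx^\mu=-\Gamma^\mu_{\alpha\beta}dx^\alpha\otimes dx^\beta+B^\mu_{i\alpha}(dx^\alpha\otimes s^i+s^i\otimes dx^\alpha)+C^\mu(s^1\otimes s^2-s^2\otimes s^1),$$ $$\nabla s^k=D^k_{\alpha\beta}dx^\alpha\otimes dx^\beta+E^k_{i\alpha}(dx^\alpha\otimes s^i+s^i\otimes dx^\alpha)+\gamma^k_{ijp}\sigma^ps^i\otimes s^j,$$ where, with $C_\alpha=g_{\alpha\nu}C^\nu$, the remaining fields are determined as $B^\mu_{1\alpha}=\frac12\tilde g^{\mu\beta}(\nabla_\beta A_\alpha-\nabla_\alpha A_\beta)$, $B^\mu_{2\alpha}=-\frac1h\tilde g^{\mu\beta}A_\beta C_\alpha$, $D^1_{\alpha\beta}=\frac{\imath}{h^2}A_\alpha A_\beta\sigma^1-\frac1{2h}(\nabla_\alpha A_\beta+\nabla_\beta A_\alpha)$, $D^2_{\alpha\beta}=0$, $E^1_{1\alpha}=\frac{\imath}{h}A_\alpha\sigma^1-\frac1hA_\mu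 B^\mu_{1\alpha}$, $E^1_{2\alpha}=\frac1h(C_\alpha-A_\mu B^\mu_{2\alpha})$, $E^2_{1\alpha}=\frac1hC_\alpha$, $E^2_{2\alpha}=0$. (c) $(\mathfrak g,\nabla)$ is a $*$-QLC solution if and only if in addition $g_{\mu\nu},A_\mu,h,\Gamma^\mu_{\alpha\beta},C^\mu$ are real and $\rho$ is imaginary (it may vary over $M$). In particular, if $M$ is connected, $h$ is then a real constant. (d) At each point of $M$, the finite geometry on $M_2(\mathbb C)$ with metric $h(s^1\otimes s^1-s^2\otimes s^2)$ and connection $\gamma$ has Laplacian $\Delta_{M_2}=(\ ,\ )\nabla d=0$ and scalar curvature $S_{M_2}=\frac{2\rho^2}{h}$, the latter computed with the lift $i(\mathrm{Vol})=\frac1{2\imath}(s^1\otimes s^1+s^2\otimes s^2)$ and $R_\nabla=(d\otimes\mathrm{id}-\mathrm{id}\wedge\nabla)\nabla$. -/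

import Mathlib

open scoped ContDiff Manifold Matrix

noncomputable section

namespace QKK

/-! Conventions.  The algebra is `C^∞(M) ⊗ M₂(ℂ)`, i.e. smooth `M₂(ℂ)`-valued functions.  Over a
coordinate patch `U ⊆ ℝⁿ` the bimodule `Ω¹` is free with the central basis
`e^a = dx^μ` (`a = inl μ`) and `e^a = s^i` (`a = inr i`).  Elements of `Ω¹`, `Ω¹ ⊗ Ω¹`,
`Ω¹ ⊗ Ω¹ ⊗ Ω¹` are given by their `M₂(ℂ)`-valued coefficients in this basis.  The internal indices
`1, 2` are `0, 1 : Fin 2`.  Fields on a patch are total functions on `ℝⁿ`, used only on `U`. -/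

abbrev E (n : ℕ) := EuclideanSpace ℝ (Fin n)
abbrev Mat := Matrix (Fin 2) (Fin 2) ℂ
abbrev Idx (n : ℕ) := Fin n ⊕ Fin 2
abbrev OneForm (n : ℕ) := E n → Idx n → Mat
abbrev TwoTensor (n : ℕ) := E n → Idx n → Idx n → Mat
abbrev ThreeTensor (n : ℕ) := E n → Idx n → Idx n → Idx n → Mat

/-- The Pauli matrices `σ¹, σ²`. -/
def sigma : Fin 2 → Mat := ![!![0, 1; 1, 0], !![0, -Complex.I; Complex.I, 0]]

/-- The derivations `∂₁, ∂₂` of `M₂(ℂ)`, `d f = (∂_i f) s^i`: inner derivations with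
`∂_i σ^j = - ε_{ijk} σ^k`. -/
def matD (i : Fin 2) (m : Mat) : Mat := (Complex.I / 2) • (sigma i * m - m * sigma i)

/-- Partial derivative of a scalar function on `ℝⁿ`. -/
def pd {n : ℕ} (μ : Fin n) (f : E n → ℂ) (y : E n) : ℂ :=
  fderiv ℝ f y (EuclideanSpace.single μ (1 : ℝ))

/-- The coefficient of `e^a` in `d f`, for an `M₂(ℂ)`-valued function `f`. -/
def dCoef {n : ℕ} : Idx n → (E n → Mat) → E n → Mat
  | Sum.inl μ, f, y => Matrix.of fun i j => pd μ (fun z => f z i j) y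
  | Sum.inr i, f, y => matD i (f y)

def SmoothFun {n : ℕ} (U : Set (E n)) (f : E n → Mat) : Prop :=
  ∀ i j, ContDiffOn ℝ ∞ (fun y => f y i j) U

def SmoothForm {n : ℕ} (U : Set (E n)) (η : OneForm n) : Prop :=
  ∀ a, SmoothFun U fun y => η y a

/-- An element of `Ω²` at a point: the coefficients of `dx^μ ∧ dx^ν` (antisymmetrised), of
`dx^μ ∧ s^i`, and of `Vol`. -/
@[ext]
structure TwoForm (n : ℕ) where
  dd : Fin n → Fin n → Mat
  ds : Fin n → Fin 2 → Mat
  vol : Mat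

/-- The wedge product `Ω¹ ⊗ Ω¹ → Ω²`: the `dx^μ` anticommute with each other and with the `s^i`,
while `s¹ ∧ s¹ = s² ∧ s² = i Vol` and `s¹ ∧ s² = s² ∧ s¹ = 0`. -/
def wedge {n : ℕ} (T : Idx n → Idx n → Mat) : TwoForm n where
  dd μ ν := T (Sum.inl μ) (Sum.inl ν) - T (Sum.inl ν) (Sum.inl μ)
  ds μ i := T (Sum.inl μ) (Sum.inr i) - T (Sum.inr i) (Sum.inl μ)
  vol := Complex.I • (T (Sum.inr 0) (Sum.inr 0) + T (Sum.inr 1) (Sum.inr 1))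

/-- `d : Ω¹ → Ω²`, `d(η_a e^a) = dη_a ∧ e^a + η_a de^a` with `d dx^μ = 0`, `d s^i = - σ^i Vol`. -/
def extD {n : ℕ} (η : OneForm n) (y : E n) : TwoForm n :=
  let W := wedge fun b a => dCoef b (fun z => η z a) y
  { dd := W.dd, ds := W.ds, vol := W.vol - ∑ i, η y (Sum.inr i) * sigma i }

/-- The left connection on `Ω¹` with `∇ e^a = N^a_{bc} e^b ⊗ e^c` (the first lower index of `N` is
the differentiating one); every left connection on the free module `Ω¹` is of this form. -/
def nabla {n : ℕ} (N : ThreeTensor n) (η : OneForm n) : TwoTensor n := fun y b c =>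
  dCoef b (fun z => η z c) y + ∑ a, η y a * N y a b c

/-- The left module map on `Ω¹ ⊗ Ω¹` with `σ(e^a ⊗ e^b) = S^{ab}_{cd} e^c ⊗ e^d`. -/
def braid {n : ℕ} (S : E n → Idx n → Idx n → Idx n → Idx n → Mat) (T : TwoTensor n) :
    TwoTensor n := fun y c d => ∑ a, ∑ b, T y a b * S y a b c d

/-- `(∇, σ)` is a bimodule connection over `U`. -/
structure IsBimoduleConnection {n : ℕ} (U : Set (E n)) (N : ThreeTensor n)
    (S : E n → Idx n → Idx n → Idx n → Idx n → Mat) : Prop where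
  right_linear : ∀ (T : TwoTensor n) (f : E n → Mat), ∀ y ∈ U, ∀ c d,
    braid S (fun z a b => T z a b * f z) y c d = braid S T y c d * f y
  right_leibniz : ∀ (η : OneForm n) (f : E n → Mat), SmoothForm U η → SmoothFun U f →
    ∀ y ∈ U, ∀ b c, nabla N (fun z a => η z a * f z) y b c
      = nabla N η y b c * f y + braid S (fun z a d => η z a * dCoef d f z) y b c

/-- The flip assumption `σ(dx^μ ⊗ s^i) = s^i ⊗ dx^μ`. -/
def FlipAssumption {n : ℕ} (U : Set (E n))
    (S : E n → Idx n → Idx n → Idx n → Idx n → Mat) : Prop :=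
  ∀ y ∈ U, ∀ μ i c d, S y (Sum.inl μ) (Sum.inr i) c d
    = if c = Sum.inr i ∧ d = Sum.inl μ then 1 else 0

/-- `(∇ ⊗ id + (σ ⊗ id)(id ⊗ ∇)) T` for `T = T_{ab} e^a ⊗ e^b`. -/
def nabla2 {n : ℕ} (N : ThreeTensor n) (S : E n → Idx n → Idx n → Idx n → Idx n → Mat)
    (T : TwoTensor n) : ThreeTensor n := fun y c d b =>
  nabla N (fun z a => T z a b) y c d
    + ∑ a, ∑ e, (∑ k, T y a k * N y k e b) * S y a e c d

/-- Quantum metric: quantum symmetric, and invertible by a bimodule map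
`( , ) : Ω¹ ⊗ Ω¹ → A`, `P^{ab} = (e^a, e^b)`. -/
def IsQuantumMetric {n : ℕ} (U : Set (E n)) (G : TwoTensor n) : Prop :=
  (∀ y ∈ U, wedge (G y) = ⟨0, 0, 0⟩) ∧
  ∃ P : TwoTensor n, ∀ y ∈ U,
    (∀ a b (m : Mat), m * P y a b = P y a b * m) ∧
    (∀ c b, ∑ a, G y a b * P y c a = if c = b then 1 else 0) ∧
    (∀ a c, ∑ b, G y a b * P y b c = if a = c then 1 else 0)

/-- Quantum Levi-Civita connection: a torsion free, metric compatible bimodule connection. -/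
structure IsQLC {n : ℕ} (U : Set (E n)) (G : TwoTensor n) (N : ThreeTensor n)
    (S : E n → Idx n → Idx n → Idx n → Idx n → Mat) : Prop where
  bimodule : IsBimoduleConnection U N S
  torsion_free : ∀ η, SmoothForm U η → ∀ y ∈ U, wedge (nabla N η y) = extD η y
  metric_compatible : ∀ y ∈ U, nabla2 N S G y = 0

/-- `*` on `Ω¹`; the `e^a` are self-adjoint. -/
def starForm {n : ℕ} (η : OneForm n) : OneForm n := fun y a => (η y a)ᴴ

/-- `† = flip (* ⊗ *)` on `Ω¹ ⊗ Ω¹`. -/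
def dagger {n : ℕ} (T : TwoTensor n) : TwoTensor n := fun y a b => (T y b a)ᴴ

/-- `∇ ∘ * = σ ∘ † ∘ ∇`. -/
def StarPreserving {n : ℕ} (U : Set (E n)) (N : ThreeTensor n)
    (S : E n → Idx n → Idx n → Idx n → Idx n → Mat) : Prop :=
  ∀ η, SmoothForm U η → ∀ y ∈ U,
    nabla N (starForm η) y = braid S (dagger (nabla N η)) y

/-- The coefficients of
`g_{μν} dx^μ ⊗ dx^ν + A_{iμ} (s^i ⊗ dx^μ + dx^μ ⊗ s^i) + h (s¹ ⊗ s¹ - s² ⊗ s²)`. -/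
def metricCoef {n : ℕ} (g : Fin n → Fin n → ℂ) (A : Fin 2 → Fin n → ℂ) (h : ℂ) :
    Idx n → Idx n → ℂ
  | Sum.inl μ, Sum.inl ν => g μ ν
  | Sum.inl μ, Sum.inr i => A i μ
  | Sum.inr i, Sum.inl μ => A i μ
  | Sum.inr i, Sum.inr j => h * Matrix.diagonal ![1, -1] i j

/-- The coefficients `γ^k_{ijp}` of the 3-parameter family, in the order `k, i, j, p`. -/
def gammaCoef (u v ρ : ℂ) : Fin 2 → Fin 2 → Fin 2 → Fin 2 → ℂ :=
  let I := Complex.I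
  let a := I / (8 * ρ) * ((v + u - 2) * (v - u + 2 * ρ) + 8 * ρ)
  let c := (u + v) / (8 * ρ) * (2 - u - v)
  let b := I / 2 * (u + v) - a
  ![![![![a, c], ![c, b]],
      ![![c + (u - v) / 2 - ρ, I - a], ![I - a, -c]]],
    ![![![-c, -b], ![-b, c - (u - v) / 2 - ρ]],
      ![![-(I - a), c], ![c, I / 2 * (u + v + 2) - a]]]]

/-- `γ^k_{ij} = γ^k_{ijp} σ^p`. -/
def gamma (u v ρ : ℂ) (k i j : Fin 2) : Mat := ∑ p, gammaCoef u v ρ k i j p • sigma p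

/-! The finite geometry on `M₂(ℂ)`, with metric `h (s¹ ⊗ s¹ - s² ⊗ s²)` and connection
`∇ s^k = γ^k_{ij} s^i ⊗ s^j`. -/

/-- The coefficients of `h (s¹ ⊗ s¹ - s² ⊗ s²)`; those of its inverse are `finMetric h⁻¹`. -/
def finMetric (h : ℂ) (i j : Fin 2) : ℂ := h * Matrix.diagonal ![1, -1] i j

/-- The coefficient of `Vol` in `T_{ij} s^i ∧ s^j`. -/
def finWedge (T : Fin 2 → Fin 2 → Mat) : Mat := Complex.I • (T 0 0 + T 1 1)

/-- The coefficient of `Vol` in `d(η_i s^i)`. -/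
def finD (η : Fin 2 → Mat) : Mat := finWedge (fun i j => matD i (η j)) - ∑ i, η i * sigma i

/-- `Δ f = ( , ) ∇ d f`. -/
def finLaplacian (h : ℂ) (γ : Fin 2 → Fin 2 → Fin 2 → Mat) (f : Mat) : Mat :=
  ∑ i, ∑ j, finMetric h⁻¹ i j • (matD i (matD j f) + ∑ k, matD k f * γ k i j)

/-- `R_∇ s^k = (d ⊗ id - id ∧ ∇) ∇ s^k = finCurv γ k l Vol ⊗ s^l` (sum over `l`). -/
def finCurv (γ : Fin 2 → Fin 2 → Fin 2 → Mat) (k l : Fin 2) : Mat :=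
  finD (fun i => γ k i l) - ∑ j, finWedge (fun i p => γ k i j * γ j p l)

/-- The coefficients of `Ricci = (( , ) ⊗ id)(id ⊗ i ⊗ id)(id ⊗ R_∇) 𝔤`, for the lift
`i(Vol) = (1 / 2i) (s¹ ⊗ s¹ + s² ⊗ s²)`. -/
def finRicci (h : ℂ) (γ : Fin 2 → Fin 2 → Fin 2 → Mat) (m l : Fin 2) : Mat :=
  ∑ a, ∑ b, (finMetric h a b * finMetric h⁻¹ a m * (1 / (2 * Complex.I))) • finCurv γ b l

/-- `S = ( , ) Ricci`. -/
def finScalar (h : ℂ) (γ : Fin 2 → Fin 2 → Fin 2 → Mat) : Mat :=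
  ∑ m, ∑ l, finMetric h⁻¹ m l • finRicci h γ m l

/-! Tensor calculus on a patch for a torsion free classical connection `Γ^μ_{αβ}`
(`Γ y μ α β`). -/

/-- `∇_α A_β`. -/
def covA {n : ℕ} (Γ : E n → Fin n → Fin n → Fin n → ℂ) (A : E n → Fin n → ℂ) (y : E n)
    (α β : Fin n) : ℂ :=
  pd α (fun z => A z β) y - ∑ μ, Γ y μ α β * A y μ

/-- `∇_α g_{βν}`. -/
def covG {n : ℕ} (Γ : E n → Fin n → Fin n → Fin n → ℂ) (g : E n → Fin n → Fin n → ℂ) (y : E n)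
    (α β ν : Fin n) : ℂ :=
  pd α (fun z => g z β ν) y - ∑ μ, Γ y μ α β * g y μ ν - ∑ μ, Γ y μ α ν * g y β μ

/-- `g̃_{μν} = g_{μν} - A_μ A_ν / h`. -/
def gTilde {n : ℕ} (g : Fin n → Fin n → ℂ) (A : Fin n → ℂ) (h : ℂ) : Matrix (Fin n) (Fin n) ℂ :=
  Matrix.of fun μ ν => g μ ν - A μ * A ν / h

/-- The coefficients of `∇ dx^μ = - Γ^μ_{αβ} dx^α ⊗ dx^β`, `∇ s^k = γ^k_{ij} s^i ⊗ s^j`. -/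
def directSumConn {n : ℕ} (Γ : Fin n → Fin n → Fin n → ℂ) (γ : Fin 2 → Fin 2 → Fin 2 → Mat) :
    Idx n → Idx n → Idx n → Mat
  | Sum.inl μ, Sum.inl α, Sum.inl β => (-Γ μ α β) • 1
  | Sum.inr k, Sum.inr i, Sum.inr j => γ k i j
  | _, _, _ => 0

/-- `B^μ_{iα}`, in terms of `g̃`, `A`, `h`, of `nA α β = ∇_α A_β` and of `cl α = g_{αν} C^ν`:
`B^μ_{1α} = ½ g̃^{μβ} (∇_β A_α - ∇_α A_β)` and `B^μ_{2α} = - (1/h) g̃^{μβ} A_β C_α`. -/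
def bField {n : ℕ} (gt : Matrix (Fin n) (Fin n) ℂ) (A : Fin n → ℂ) (h : ℂ)
    (nA : Fin n → Fin n → ℂ) (cl : Fin n → ℂ) (i : Fin 2) (μ α : Fin n) : ℂ :=
  ![1 / 2 * ∑ β, gt⁻¹ μ β * (nA β α - nA α β), -(1 / h) * (∑ β, gt⁻¹ μ β * A β) * cl α] i

/-- `E^k_{iα}`, in terms of the `B^μ_{iα}`:
`E^1_{1α} = (i/h) A_α σ¹ - (1/h) A_μ B^μ_{1α}`, `E^1_{2α} = (1/h) (C_α - A_μ B^μ_{2α})`,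
`E^2_{1α} = (1/h) C_α`, `E^2_{2α} = 0`. -/
def eField {n : ℕ} (A : Fin n → ℂ) (h : ℂ) (B : Fin 2 → Fin n → Fin n → ℂ) (cl : Fin n → ℂ)
    (k i : Fin 2) (α : Fin n) : Mat :=
  ![![(Complex.I / h * A α) • sigma 0 - (1 / h * ∑ μ, A μ * B 0 μ α) • 1,
      (1 / h * (cl α - ∑ μ, A μ * B 1 μ α)) • 1],
    ![(1 / h * cl α) • 1, 0]] k i

/-- `D^1_{αβ} = (i/h²) A_α A_β σ¹ - (1/2h) (∇_α A_β + ∇_β A_α)`, `D^2_{αβ} = 0`. -/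
def dField {n : ℕ} (A : Fin n → ℂ) (h : ℂ) (nA : Fin n → Fin n → ℂ) (k : Fin 2)
    (α β : Fin n) : Mat :=
  ![(Complex.I / h ^ 2 * (A α * A β)) • sigma 0 - (1 / (2 * h) * (nA α β + nA β α)) • 1, 0] k

/-- The coefficients, at a point, of the connection
`∇ dx^μ = - Γ^μ_{αβ} dx^α ⊗ dx^β + B^μ_{iα} (dx^α ⊗ s^i + s^i ⊗ dx^α)
  + C^μ (s¹ ⊗ s² - s² ⊗ s¹)`,
`∇ s^k = D^k_{αβ} dx^α ⊗ dx^β + E^k_{iα} (dx^α ⊗ s^i + s^i ⊗ dx^α) + γ^k_{ij} s^i ⊗ s^j`,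
with `B`, `D`, `E` as above and `γ` the member `u = 1 + ρ`, `v = 1 - ρ` of the family. -/
def solutionConn {n : ℕ} (g : Fin n → Fin n → ℂ) (A : Fin n → ℂ) (h ρ : ℂ)
    (Γ : Fin n → Fin n → Fin n → ℂ) (nA : Fin n → Fin n → ℂ) (C : Fin n → ℂ) :
    Idx n → Idx n → Idx n → Mat :=
  let cl : Fin n → ℂ := fun α => ∑ ν, g α ν * C ν
  let B := bField (gTilde g A h) A h nA cl
  fun a b c => match a, b, c with
  | Sum.inl μ, Sum.inl α, Sum.inl β => (-Γ μ α β) • 1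
  | Sum.inl μ, Sum.inl α, Sum.inr i => B i μ α • 1
  | Sum.inl μ, Sum.inr i, Sum.inl α => B i μ α • 1
  | Sum.inl μ, Sum.inr i, Sum.inr j => (C μ * !![0, 1; -1, 0] i j) • 1
  | Sum.inr k, Sum.inl α, Sum.inl β => dField A h nA k α β
  | Sum.inr k, Sum.inl α, Sum.inr i => eField A h B cl k i α
  | Sum.inr k, Sum.inr i, Sum.inl α => eField A h B cl k i α
  | Sum.inr k, Sum.inr i, Sum.inr j => gamma (1 + ρ) (1 - ρ) ρ k i j

/-! Global data on a smooth manifold `M`, through local coordinates. -/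

/-- The local coordinate charts of `M`. -/
abbrev charts (n : ℕ) (M : Type*) [TopologicalSpace M] [ChartedSpace (E n) M] :
    Set (OpenPartialHomeomorph M (E n)) :=
  IsManifold.maximalAtlas (modelWithCornersSelf ℝ (E n)) ∞ M

/-- The basis change `e'^a = J^a_q e^q` between the bases of `Ω¹` of two charts `e`, `e'`, at the
point with `e`-coordinates `y`: the Jacobian on the `dx^μ`, the identity on the `s^i`. -/
def jac {n : ℕ} {M : Type*} [TopologicalSpace M] (e e' : OpenPartialHomeomorph M (E n))
    (y : E n) : Idx n → Idx n → ℂ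
  | Sum.inl μ, Sum.inl α => ((fderiv ℝ (fun z => e' (e.symm z)) y
      (EuclideanSpace.single α (1 : ℝ))) μ : ℝ)
  | Sum.inr i, Sum.inr j => if i = j then 1 else 0
  | _, _ => 0

/-- A tensor `𝔤 = g + A_i ⊗ s^i + s^i ⊗ A_i + h (s¹ ⊗ s¹ - s² ⊗ s²)` and a left connection `∇` on
the 1-forms of `C^∞(M) ⊗ M₂(ℂ)`, given by their coefficients in every chart (as functions of the
coordinates) subject to the transformation rules between charts. -/
structure Geometry (n : ℕ) (M : Type*) [TopologicalSpace M] [ChartedSpace (E n) M] where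
  g : OpenPartialHomeomorph M (E n) → E n → Fin n → Fin n → ℂ
  A : OpenPartialHomeomorph M (E n) → E n → Fin 2 → Fin n → ℂ
  h : M → ℂ
  conn : OpenPartialHomeomorph M (E n) → ThreeTensor n
  g_smooth : ∀ e ∈ charts n M, ∀ μ ν, ContDiffOn ℝ ∞ (fun y => g e y μ ν) e.target
  g_symm : ∀ e ∈ charts n M, ∀ y ∈ e.target, ∀ μ ν, g e y μ ν = g e y ν μ
  A_smooth : ∀ e ∈ charts n M, ∀ i μ, ContDiffOn ℝ ∞ (fun y => A e y i μ) e.target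
  h_smooth : ContMDiff (modelWithCornersSelf ℝ (E n)) (modelWithCornersSelf ℝ ℂ) ∞ h
  conn_smooth : ∀ e ∈ charts n M, ∀ a b c, SmoothFun e.target fun y => conn e y a b c
  metric_change : ∀ e ∈ charts n M, ∀ e' ∈ charts n M, ∀ y ∈ e.target, e.symm y ∈ e'.source →
    ∀ p q, metricCoef (g e y) (A e y) (h (e.symm y)) p q
      = ∑ c, ∑ d, jac e e' y c p * jac e e' y d q
          * metricCoef (g e' (e' (e.symm y))) (A e' (e' (e.symm y))) (h (e.symm y)) c d
  conn_change : ∀ e ∈ charts n M, ∀ e' ∈ charts n M, ∀ y ∈ e.target, e.symm y ∈ e'.source →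
    ∀ a p q, nabla (conn e) (fun z r => jac e e' z a r • 1) y p q
      = ∑ c, ∑ d, (jac e e' y c p * jac e e' y d q) • conn e' (e' (e.symm y)) a c d

variable {n : ℕ} {M : Type*} [TopologicalSpace M] [ChartedSpace (E n) M]

/-- The tensor `𝔤` in a chart. -/
def Geometry.metric (X : Geometry n M) (e : OpenPartialHomeomorph M (E n)) : TwoTensor n :=
  fun y a b => metricCoef (X.g e y) (X.A e y) (X.h (e.symm y)) a b • 1

/-- `𝔤` is a quantum metric and `∇` is a quantum Levi-Civita connection for it whose generalised
braiding obeys the flip assumption. -/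
def Geometry.IsQLC (X : Geometry n M) : Prop :=
  ∀ e ∈ charts n M, IsQuantumMetric e.target (X.metric e) ∧
    ∃ S, FlipAssumption e.target S ∧ QKK.IsQLC e.target (X.metric e) (X.conn e) S

/-- In addition `𝔤† = 𝔤` and `∇` is `*`-preserving. -/
def Geometry.IsStarQLC (X : Geometry n M) : Prop :=
  ∀ e ∈ charts n M, IsQuantumMetric e.target (X.metric e) ∧
    (∀ y ∈ e.target, dagger (X.metric e) y = X.metric e y) ∧
    ∃ S, FlipAssumption e.target S ∧ QKK.IsQLC e.target (X.metric e) (X.conn e) S ∧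
      StarPreserving e.target (X.conn e) S

/-- The `s^i ⊗ s^j` part of `∇ s^k` is the 3-parameter connection with parameters `u, v, ρ`, which
may vary over `M`. -/
def Geometry.HasInner (X : Geometry n M) (u v ρ : M → ℂ) : Prop :=
  ∀ e ∈ charts n M, ∀ y ∈ e.target, ∀ k i j,
    X.conn e y (Sum.inr k) (Sum.inr i) (Sum.inr j)
      = gamma (u (e.symm y)) (v (e.symm y)) (ρ (e.symm y)) k i j

/-- `Γ` and `C` are fields in the chart `e` with `Γ` symmetric in its lower indices, satisfying
`∇_μ g_{σν} = (1/2h) (A_ν (∇_σ A_μ + ∇_μ A_σ) + A_σ (∇_ν A_μ + ∇_μ A_ν))` and `A_μ C^μ = 0`, where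
`A = A_1`, and the connection is the one built from `g, A, h, ρ, Γ, C` in `solutionConn`. -/
structure Geometry.IsSolution (X : Geometry n M) (ρ : M → ℂ) (e : OpenPartialHomeomorph M (E n))
    (Γ : E n → Fin n → Fin n → Fin n → ℂ) (C : E n → Fin n → ℂ) : Prop where
  Γ_smooth : ∀ μ α β, ContDiffOn ℝ ∞ (fun y => Γ y μ α β) e.target
  C_smooth : ∀ μ, ContDiffOn ℝ ∞ (fun y => C y μ) e.target
  Γ_symm : ∀ y ∈ e.target, ∀ μ α β, Γ y μ α β = Γ y μ β α
  covariant : ∀ y ∈ e.target, ∀ μ σ ν,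
    let nA := covA Γ (fun z => X.A e z 0) y
    covG Γ (X.g e) y μ σ ν = 1 / (2 * X.h (e.symm y))
      * (X.A e y 0 ν * (nA σ μ + nA μ σ) + X.A e y 0 σ * (nA ν μ + nA μ ν))
  orthogonal : ∀ y ∈ e.target, ∑ μ, X.A e y 0 μ * C y μ = 0
  conn_eq : ∀ y ∈ e.target, X.conn e y
    = solutionConn (X.g e y) (X.A e y 0) (X.h (e.symm y)) (ρ (e.symm y)) (Γ y)
        (covA Γ (fun z => X.A e z 0) y) (C y)

end QKK

end

noncomputable section

namespace QKK

/-! ### The derivations `dCoef` -/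

section Derivations

variable {n : ℕ}

/-! The bimodule axioms reduce the matrix-valued problem to scalar tables. Right linearity makes the
coefficients of the braiding central. The right Leibniz rule, tested on constant matrices and
coordinate functions, together with the flip assumption, forces `∇ dx^μ` to have scalar coefficients
and `∇ s^k` to have coefficients in the span of `1, σ¹, σ²`. The braiding is then the flip corrected
by `2i` times the Pauli coefficients (`isBimoduleConnection_flip_iff`). So a quantum Levi-Civita
connection amounts, point by point, to a scalar part `nn` and a Pauli part `mm` satisfying algebraic
equations that involve the metric and its first derivatives (`exists_isQLC_iff`). Metric and
braiding being scalar, compatibility splits: its Pauli part involves `mm` alone, and its scalar part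
is affine in `nn` once `mm` is known.

The dichotomy uses only the Pauli part on mixed triples. Two orders of the indices, related by
torsion freeness, express the mixed entries of `mm` through `A`. Substituting back leaves
homogeneous linear relations on `A_1, A_2` (`inner_relation`). They contain a 2×2 system with
determinant `-4((u-1)(v-1)+ρ²)`, so either `A = 0` or the determinant vanishes (`two_cases`).

For `u = 1+ρ`, `v = 1-ρ` the inner connection collapses to three entries and the Pauli equations
determine `mm` (`eq_solutionM`). In the scalar equations the braiding correction multiplies
contractions that turn out to vanish. What remains is compatibility for the ordinary flip in `n+2`
directions, with torsion freeness weaker than symmetry in the inner block; this leaves room for the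
field `C`. Eliminating the `s¹` direction produces the Schur complement `g̃`, hence the explicit
formulas (`solution_of_pointQLC`); the same cancellations give the converse (`pointQLC_solution`).
The scalar part of the `*`-condition says that `nn` is real, and the entry `-2ρ` of the inner
connection forces `ρ` to be imaginary.

The Laplacian vanishes because `∂_i² f = -i (∂_i f) σ^i`, and the curvature of the finite geometry
reduces to one entry proportional to `ρ²`. -/

lemma matD_mul (i : Fin 2) (a b : Mat) : matD i (a * b) = matD i a * b + a * matD i b := by
  simp only [matD, smul_mul_assoc, mul_smul_comm, ← smul_add]
  congr 1
  noncomm_ring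

lemma sigma_conjTranspose (i : Fin 2) : (sigma i)ᴴ = sigma i := by
  ext k l
  fin_cases i <;> fin_cases k <;> fin_cases l <;> simp [sigma, Matrix.conjTranspose_apply]

/-- Conjugation changes the sign of `i/2` and reverses the commutator; the two signs cancel. -/
lemma matD_conjTranspose (i : Fin 2) (m : Mat) : matD i mᴴ = (matD i m)ᴴ := by
  simp only [matD, Matrix.conjTranspose_smul, Matrix.conjTranspose_sub, Matrix.conjTranspose_mul,
    sigma_conjTranspose]
  rw [← neg_sub (mᴴ * sigma i), smul_neg, ← neg_smul]
  congr 1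
  simp [neg_div]

lemma matD_smul_one (i : Fin 2) (c : ℂ) : matD i (c • (1 : Mat)) = 0 := by
  simp [matD]

lemma pd_const (μ : Fin n) (c : ℂ) (y : E n) : pd μ (fun _ => c) y = 0 := by
  simp [pd]

lemma pd_mul {f g : E n → ℂ} {y : E n} (μ : Fin n) (hf : DifferentiableAt ℝ f y)
    (hg : DifferentiableAt ℝ g y) :
    pd μ (fun z => f z * g z) y = pd μ f y * g y + f y * pd μ g y := by
  simp only [pd]
  rw [fderiv_fun_mul hf hg]
  simp
  ring

lemma pd_add {f g : E n → ℂ} {y : E n} (μ : Fin n) (hf : DifferentiableAt ℝ f y)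
    (hg : DifferentiableAt ℝ g y) :
    pd μ (fun z => f z + g z) y = pd μ f y + pd μ g y := by
  simp only [pd]
  rw [fderiv_fun_add hf hg]
  simp

lemma pd_conj (f : E n → ℂ) (y : E n) (μ : Fin n) :
    pd μ (fun z => star (f z)) y = star (pd μ f y) := by
  simp only [pd]
  rw [fderiv_star]
  simp

lemma pd_coord (μ ν : Fin n) (y : E n) :
    pd μ (fun z => ((z ν : ℝ) : ℂ)) y = if μ = ν then 1 else 0 := by
  have h : HasFDerivAt (fun z : E n => ((z ν : ℝ) : ℂ))
      (Complex.ofRealCLM.comp (EuclideanSpace.proj ν)) y :=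
    (Complex.ofRealCLM.comp (EuclideanSpace.proj (𝕜 := ℝ) ν)).hasFDerivAt
  rw [pd, h.fderiv]
  by_cases hμ : μ = ν
  · subst hμ; simp
  · have : ν ≠ μ := fun h => hμ h.symm
    simp [hμ, this]

lemma SmoothFun.differentiableAt {U : Set (E n)} (hU : IsOpen U) {f : E n → Mat}
    (hf : SmoothFun U f) {y : E n} (hy : y ∈ U) (i j : Fin 2) :
    DifferentiableAt ℝ (fun z => f z i j) y :=
  ((hf i j).differentiableOn (by simp)).differentiableAt (hU.mem_nhds hy)

lemma dCoef_mul {U : Set (E n)} (hU : IsOpen U) {f g : E n → Mat} (hf : SmoothFun U f)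
    (hg : SmoothFun U g) {y : E n} (hy : y ∈ U) (b : Idx n) :
    dCoef b (fun z => f z * g z) y = dCoef b f y * g y + f y * dCoef b g y := by
  rcases b with μ | i
  · ext k l
    have hf' := hf.differentiableAt hU hy
    have hg' := hg.differentiableAt hU hy
    simp only [dCoef, Matrix.of_apply, Matrix.mul_apply, Matrix.add_apply, Fin.sum_univ_two]
    rw [pd_add _ ((hf' k 0).fun_mul (hg' 0 l)) ((hf' k 1).fun_mul (hg' 1 l)),
      pd_mul _ (hf' k 0) (hg' 0 l), pd_mul _ (hf' k 1) (hg' 1 l)]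
    ring
  · exact matD_mul i (f y) (g y)

lemma dCoef_conjTranspose (f : E n → Mat) (y : E n) (b : Idx n) :
    dCoef b (fun z => (f z)ᴴ) y = (dCoef b f y)ᴴ := by
  rcases b with μ | i
  · ext k l
    simp only [dCoef, Matrix.of_apply, Matrix.conjTranspose_apply]
    exact pd_conj _ _ _
  · exact matD_conjTranspose i (f y)

/-- The values on a constant function of the derivations `dCoef`. -/
def constD (m : Mat) : Idx n → Mat
  | Sum.inl _ => 0
  | Sum.inr i => matD i m

lemma constD_inl (m : Mat) (μ : Fin n) : constD m (Sum.inl μ) = 0 := rfl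

lemma constD_inr (m : Mat) (i : Fin 2) : constD (n := n) m (Sum.inr i) = matD i m := rfl

lemma dCoef_const (m : Mat) (y : E n) (b : Idx n) : dCoef b (fun _ => m) y = constD m b := by
  rcases b with μ | i
  · ext k l
    simp [dCoef, constD, pd_const]
  · rfl

lemma constD_smul_one (c : ℂ) (b : Idx n) : constD (c • (1 : Mat)) b = 0 := by
  rcases b with μ | i
  · rfl
  · exact matD_smul_one i c

lemma dCoef_zero (y : E n) (b : Idx n) : dCoef b (fun _ => (0 : Mat)) y = 0 := by
  rw [dCoef_const]
  simpa using constD_smul_one (n := n) 0 b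

/-- The values on a scalar function of the derivations `dCoef`. -/
def scalarD (f : E n → ℂ) (y : E n) : Idx n → ℂ
  | Sum.inl μ => pd μ f y
  | Sum.inr _ => 0

lemma dCoef_smul_one (f : E n → ℂ) (y : E n) (b : Idx n) :
    dCoef b (fun z => f z • (1 : Mat)) y = scalarD f y b • 1 := by
  rcases b with μ | i
  · ext k l
    by_cases h : k = l
    · subst h; simp [dCoef, scalarD]
    · simp [dCoef, scalarD, h, pd_const]
  · simp [dCoef, scalarD, matD_smul_one]

lemma smoothFun_const (U : Set (E n)) (m : Mat) : SmoothFun U fun _ => m :=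
  fun _ _ => contDiffOn_const

lemma smoothFun_coord (U : Set (E n)) (ν : Fin n) :
    SmoothFun U fun z => ((z ν : ℝ) : ℂ) • (1 : Mat) := by
  intro i j
  have h : ContDiff ℝ ∞ fun z : E n => ((z ν : ℝ) : ℂ) :=
    (Complex.ofRealCLM.comp (EuclideanSpace.proj (𝕜 := ℝ) ν)).contDiff
  simpa using (h.mul contDiff_const).contDiffOn

end Derivations

/-! ### Bimodule connections at a point -/

section Bimodule

variable {n : ℕ}

/-- `n^a_{bc} + m^p_{kbc} σ^p`: the coefficients of a connection with `∇ dx^μ` central. -/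
def connOf (nn : Idx n → Idx n → Idx n → ℂ) (mm : Fin 2 → Fin 2 → Idx n → Idx n → ℂ) :
    Idx n → Idx n → Idx n → Mat
  | Sum.inl μ, b, c => nn (Sum.inl μ) b c • 1
  | Sum.inr k, b, c => nn (Sum.inr k) b c • 1 + ∑ p, mm p k b c • sigma p

/-- The generalised braiding of `connOf nn mm`. -/
def braidOf (mm : Fin 2 → Fin 2 → Idx n → Idx n → ℂ) : Idx n → Idx n → Idx n → Idx n → ℂ
  | Sum.inr k, Sum.inr i, c, d =>
      (if c = Sum.inr i ∧ d = Sum.inr k then 1 else 0) + 2 * Complex.I * mm i k c d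
  | a, b, c, d => if c = b ∧ d = a then 1 else 0

/-- The constant 1-form `e^a`. -/
def basisForm (a : Idx n) : Idx n → Mat := fun c => if c = a then 1 else 0

lemma smoothForm_basisForm (U : Set (E n)) (a : Idx n) : SmoothForm U fun _ => basisForm a :=
  fun _ => smoothFun_const _ _

/-- The two off-diagonal matrix units generate `M₂(ℂ)`, so commuting with them is enough. -/
lemma eq_smul_one_of_forall_commute {x : Mat} (h : ∀ m : Mat, m * x = x * m) :
    x = x 0 0 • 1 := by
  have h1 := h !![0, 1; 0, 0]
  have h2 := h !![0, 0; 1, 0]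
  have e1 := congrFun (congrFun h1 0) 0
  have e2 := congrFun (congrFun h1 0) 1
  have e3 := congrFun (congrFun h2 0) 0
  simp [Matrix.mul_apply, Fin.sum_univ_two] at e1 e2 e3
  ext i j
  fin_cases i <;> fin_cases j <;> simp [e1, e2, ← e3]

lemma nabla_basisForm_mul {N : ThreeTensor n} (f : E n → Mat) (y : E n) (a b c : Idx n) :
    nabla N (fun z d => basisForm a d * f z) y b c
      = (if c = a then dCoef b f y else 0) + f y * N y a b c := by
  unfold nabla
  congr 1
  · by_cases h : c = a
    · simp [basisForm, h]
    · simp [basisForm, h, dCoef_zero]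
  · simp [basisForm]

lemma nabla_basisForm {N : ThreeTensor n} (y : E n) (a : Idx n) :
    nabla N (fun _ => basisForm a) y = N y a := by
  funext b c
  have h := nabla_basisForm_mul (N := N) (fun _ => 1) y a b c
  have h0 : dCoef b (fun _ : E n => (1 : Mat)) y = 0 := by
    rw [dCoef_const]; simpa using constD_smul_one (n := n) 1 b
  simpa [h0] using h

/-- The Leibniz rule of a bimodule connection on the basis, at a point. -/
def LeibnizAt (N : Idx n → Idx n → Idx n → Mat) (S : Idx n → Idx n → Idx n → Idx n → Mat)
    (F : Idx n → Mat) (m : Mat) : Prop :=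
  ∀ a b c, m * N a b c + (if c = a then F b else 0) = N a b c * m + ∑ d, F d * S a d b c

lemma IsBimoduleConnection.leibnizAt {U : Set (E n)} {N : ThreeTensor n}
    {S : E n → Idx n → Idx n → Idx n → Idx n → Mat} (H : IsBimoduleConnection U N S)
    {f : E n → Mat} (hf : SmoothFun U f) {y : E n} (hy : y ∈ U) :
    LeibnizAt (N y) (S y) (fun b => dCoef b f y) (f y) := by
  intro a b c
  have h := H.right_leibniz (fun _ => basisForm a) f (smoothForm_basisForm U a) hf y hy b c
  rw [nabla_basisForm_mul, nabla_basisForm] at h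
  rw [add_comm, h]
  simp [braid, basisForm, Finset.sum_ite_eq']

/-- Multiply the rule on each `e^a` by `η_a` on the left and sum over `a`; the Leibniz rule for
`dCoef` supplies the remaining term. -/
lemma leibniz_of_leibnizAt {U : Set (E n)} (hU : IsOpen U) {N : ThreeTensor n}
    {S : E n → Idx n → Idx n → Idx n → Idx n → Mat} {η : OneForm n} {f : E n → Mat}
    (hη : SmoothForm U η) (hf : SmoothFun U f) {y : E n} (hy : y ∈ U)
    (H : LeibnizAt (N y) (S y) (fun b => dCoef b f y) (f y)) (b c : Idx n) :
    nabla N (fun z a => η z a * f z) y b c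
      = nabla N η y b c * f y + braid S (fun z a d => η z a * dCoef d f z) y b c := by
  have h1 : ∀ a, η y a * f y * N y a b c + (if c = a then η y a * dCoef b f y else 0)
      = η y a * N y a b c * f y + ∑ d, η y a * dCoef d f y * S y a d b c := by
    intro a
    have := congrArg (fun x => η y a * x) (H a b c)
    simpa only [mul_add, mul_ite, mul_zero, mul_assoc, Finset.mul_sum] using this
  have h2 := Finset.sum_congr rfl fun a (_ : a ∈ (Finset.univ : Finset (Idx n))) => h1 a
  rw [Finset.sum_add_distrib, Finset.sum_add_distrib, Finset.sum_ite_eq] at h2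
  simp only [Finset.mem_univ, if_true] at h2
  simp only [nabla, braid, dCoef_mul hU (hη c) hf hy, add_mul, Finset.sum_mul]
  rw [add_assoc, add_assoc, add_comm (η y c * _), h2]

/-- By definition of `matD`, `m σ^p - σ^p m = 2i ∂_p m`. The failure of the Pauli part to commute
with `m` is therefore a combination of the `∂_p m`, which the `2i`-correction of the flip in
`braidOf` absorbs. Only the inner components of the differential enter this commutator, so the other
components of `F` are arbitrary. -/
lemma leibnizAt_connOf (nn : Idx n → Idx n → Idx n → ℂ)
    (mm : Fin 2 → Fin 2 → Idx n → Idx n → ℂ) {F : Idx n → Mat} {m : Mat}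
    (hF : ∀ i, F (Sum.inr i) = matD i m) :
    LeibnizAt (connOf nn mm) (fun a b c d => braidOf mm a b c d • 1) F m := by
  have hI := Complex.I_mul_I
  rintro (μ | k) b c
  · rcases b with ν | j
    · by_cases hc : c = Sum.inl μ
      · simp [connOf, braidOf, hc]
      · simp [connOf, braidOf, hc]
    · by_cases hc : c = Sum.inl μ
      · simp [connOf, braidOf, hc]
      · simp [connOf, braidOf, hc]
  · have key : m * connOf nn mm (Sum.inr k) b c = connOf nn mm (Sum.inr k) b c * m
        + ∑ i, matD i m * ((2 * Complex.I * mm i k b c) • (1 : Mat)) := by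
      simp only [connOf, matD, Fin.sum_univ_two, mul_add, add_mul, mul_smul_comm, smul_mul_assoc,
        mul_one, one_mul, smul_smul, smul_sub]
      have e : ∀ z : ℂ, 2 * Complex.I * z * (Complex.I / 2) = - z := fun z => by
        linear_combination z * hI
      simp only [e, neg_smul]
      abel
    rw [key, add_assoc]
    congr 1
    rw [Fintype.sum_sum_type]
    simp only [hF, braidOf, add_smul, mul_add, Finset.sum_add_distrib]
    rw [add_comm, ← add_assoc]
    congr 1
    rcases b with ν | j
    · by_cases hc : c = Sum.inr k
      · simp [hc]
      · simp [hc]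
    · by_cases hc : c = Sum.inr k
      · simp [hc, hF]
      · simp [hc]

/-- Converse of `leibnizAt_connOf`. The two kinds of test data are those of a constant matrix and of
a coordinate function. -/
lemma eq_connOf_of_leibnizAt {N : Idx n → Idx n → Idx n → Mat}
    {S : Idx n → Idx n → Idx n → Idx n → Mat} (hS : ∀ a b c d, S a b c d = S a b c d 0 0 • 1)
    (hflip : ∀ μ i c d, S (Sum.inl μ) (Sum.inr i) c d
      = if c = Sum.inr i ∧ d = Sum.inl μ then 1 else 0)
    (hm : ∀ m, LeibnizAt N S (constD m) m)
    (hx : ∀ ν, ∃ t : ℂ, LeibnizAt N S (fun b => if b = Sum.inl ν then 1 else 0) (t • 1)) :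
    ∃ nn mm, N = connOf nn mm ∧ S = fun a b c d => braidOf mm a b c d • 1 := by
  have hI := Complex.I_mul_I
  -- The value `t • 1` is central, so the `N`-terms cancel and the rule reads off the braiding on
  -- `e^a ⊗ dx^ν`.
  have hSx : ∀ a ν b c, S a (Sum.inl ν) b c = if b = Sum.inl ν ∧ c = a then 1 else 0 := by
    intro a ν b c
    obtain ⟨t, ht⟩ := hx ν
    have h := ht a b c
    simp only [smul_mul_assoc, one_mul, mul_smul_comm, mul_one, ite_mul, zero_mul,
      Finset.sum_ite_eq', Finset.mem_univ, if_true, add_right_inj] at h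
    rw [← h]
    by_cases h1 : c = a <;> by_cases h2 : b = Sum.inl ν <;> simp [h1, h2]
  have hmul : ∀ m a b c, m * N a b c + (if c = a then constD m b else 0)
      = N a b c * m + ∑ i, matD i m * S a (Sum.inr i) b c := by
    intro m a b c
    have := hm m a b c
    rw [Fintype.sum_sum_type] at this
    simpa [constD] using this
  -- With the flip on `dx^μ ⊗ s^i` the derivative terms on both sides agree, so these coefficients
  -- commute with every matrix.
  have hN : ∀ μ b c, N (Sum.inl μ) b c = N (Sum.inl μ) b c 0 0 • 1 := by
    intro μ b c
    apply eq_smul_one_of_forall_commute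
    intro m
    have h := hmul m (Sum.inl μ) b c
    simp only [hflip, Fin.sum_univ_two] at h
    rcases b with ν | j
    · simpa [constD] using h
    · by_cases hc : c = Sum.inl μ
      · fin_cases j <;> simpa [hc, constD] using h
      · simpa [hc] using h
  -- the coefficient of `σ^i` is determined by the braiding
  set mm : Fin 2 → Fin 2 → Idx n → Idx n → ℂ := fun i k b c =>
    (S (Sum.inr k) (Sum.inr i) b c 0 0 - (if b = Sum.inr i ∧ c = Sum.inr k then 1 else 0))
      * (-Complex.I / 2) with hmm
  have hSm : S = fun a b c d => braidOf mm a b c d • 1 := by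
    funext a b c d
    rcases a with μ | k <;> rcases b with ν | i
    · simp [hSx, braidOf]
    · simp [hflip, braidOf]
    · simp [hSx, braidOf]
    · rw [hS]
      congr 1
      simp only [braidOf, hmm]
      linear_combination (S (Sum.inr k) (Sum.inr i) c d 0 0
        - (if c = Sum.inr i ∧ d = Sum.inr k then 1 else 0)) * hI
  -- The purely Pauli model has the same braiding and obeys the same Leibniz rule; the difference
  -- from it is central.
  have hcomm : ∀ k b c (m : Mat), m * (N (Sum.inr k) b c - ∑ p, mm p k b c • sigma p)
      = (N (Sum.inr k) b c - ∑ p, mm p k b c • sigma p) * m := by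
    intro k b c m
    have h1 := hmul m (Sum.inr k) b c
    have h2 := leibnizAt_connOf (fun _ _ _ => (0 : ℂ)) mm (F := constD m) (m := m)
      (fun i => rfl) (Sum.inr k) b c
    rw [Fintype.sum_sum_type] at h2
    simp only [connOf, zero_smul, zero_add, constD_inl, constD_inr, zero_mul,
      Finset.sum_const_zero] at h2
    simp only [hSm] at h1
    rw [mul_sub, sub_mul]
    linear_combination (norm := abel) h1 - h2
  refine ⟨fun a b c => match a with
    | Sum.inl μ => N (Sum.inl μ) b c 0 0
    | Sum.inr k => (N (Sum.inr k) b c - ∑ p, mm p k b c • sigma p) 0 0, mm, ?_, hSm⟩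
  funext a b c
  rcases a with μ | k
  · exact hN μ b c
  · simp only [connOf]
    rw [← eq_smul_one_of_forall_commute (hcomm k b c)]
    abel

/-- A left connection is a bimodule connection whose braiding obeys the flip assumption if and only
if its coefficients are of the form `connOf`, the braiding being given by `braidOf`. -/
theorem isBimoduleConnection_flip_iff {U : Set (E n)} (hU : IsOpen U) {N : ThreeTensor n}
    {S : E n → Idx n → Idx n → Idx n → Idx n → Mat} :
    (IsBimoduleConnection U N S ∧ FlipAssumption U S) ↔
      ∀ y ∈ U, ∃ nn mm, N y = connOf nn mm ∧ S y = fun a b c d => braidOf mm a b c d • 1 := by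
  constructor
  · rintro ⟨H, hflip⟩ y hy
    refine eq_connOf_of_leibnizAt ?_ (hflip y hy) ?_ ?_
    -- Right linearity on `e^a ⊗ e^b` times a constant matrix: the braiding coefficients are
    -- central.
    · intro a b c d
      apply eq_smul_one_of_forall_commute
      intro m
      have h := H.right_linear (fun _ a' b' => if a' = a ∧ b' = b then 1 else 0) (fun _ => m)
        y hy c d
      simpa [braid, ite_and, Finset.sum_ite_eq'] using h
    · intro m
      have h := H.leibnizAt (smoothFun_const U m) hy
      simpa only [dCoef_const] using h
    -- The coordinate `x^ν` has a central value at the point and differential `dx^ν`.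
    · intro ν
      refine ⟨((y ν : ℝ) : ℂ), ?_⟩
      have h := H.leibnizAt (smoothFun_coord U ν) hy
      have e : (fun b : Idx n => dCoef b (fun z : E n => ((z ν : ℝ) : ℂ) • (1 : Mat)) y)
          = fun b => if b = Sum.inl ν then 1 else 0 := by
        funext b
        rw [dCoef_smul_one]
        rcases b with μ | i
        · by_cases hμ : μ = ν <;> simp [scalarD, pd_coord, hμ]
        · simp [scalarD]
      rwa [e] at h
  · intro H
    refine ⟨⟨?_, ?_⟩, ?_⟩
    · intro T f y hy c d
      obtain ⟨nn, mm, -, hS⟩ := H y hy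
      simp only [braid, hS, Finset.sum_mul, mul_smul_comm, smul_mul_assoc, mul_one]
    · intro η f hη hf y hy b c
      obtain ⟨nn, mm, hN, hS⟩ := H y hy
      refine leibniz_of_leibnizAt hU hη hf hy ?_ b c
      rw [hN, hS]
      exact leibnizAt_connOf nn mm fun i => rfl
    · intro y hy μ i c d
      obtain ⟨nn, mm, -, hS⟩ := H y hy
      simp [hS, braidOf]

end Bimodule

/-! ### Torsion, metric compatibility and `*`-preservation as scalar equations at a point. -/

section Pointwise

variable {n : ℕ}

/-- Linear independence of `1, σ¹, σ²`. As no `σ³` component occurs, three matrix entries suffice.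
-/
lemma pauli_ext_iff {z z' : ℂ} {w w' : Fin 2 → ℂ} :
    z • (1 : Mat) + ∑ p, w p • sigma p = z' • (1 : Mat) + ∑ p, w' p • sigma p
      ↔ z = z' ∧ ∀ p, w p = w' p := by
  have hI := Complex.I_mul_I
  constructor
  · intro h
    have h0 := congrFun (congrFun h 0) 0
    have h1 := congrFun (congrFun h 0) 1
    have h2 := congrFun (congrFun h 1) 0
    simp [sigma, Fin.sum_univ_two] at h0 h1 h2
    refine ⟨h0, fun p => ?_⟩
    fin_cases p
    · simp only [Fin.zero_eta]
      linear_combination (h1 + h2) / 2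
    · simp only [Fin.mk_one]
      linear_combination (h1 - h2) * Complex.I / 2 - (w' 1 - w 1) * hI
  · rintro ⟨rfl, h⟩
    simp [h]

lemma pauli_eq_zero_iff {z : ℂ} {w : Fin 2 → ℂ} :
    z • (1 : Mat) + ∑ p, w p • sigma p = 0 ↔ z = 0 ∧ ∀ p, w p = 0 := by
  have h := pauli_ext_iff (z := z) (z' := 0) (w := w) (w' := fun _ => 0)
  simpa using h

lemma smul_one_inj {z z' : ℂ} : z • (1 : Mat) = z' • (1 : Mat) ↔ z = z' :=
  smul_left_inj one_ne_zero

/-! ### Torsion -/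

/-- `- d e^a` as a multiple of `Vol`. -/
def volCoef : Idx n → Mat
  | Sum.inl _ => 0
  | Sum.inr k => sigma k

lemma sum_basisForm_mul_sigma (a : Idx n) :
    ∑ i, basisForm a (Sum.inr i) * sigma i = volCoef a := by
  rcases a with μ | k <;> simp [basisForm, volCoef]

lemma sum_mul_volCoef (η : Idx n → Mat) :
    ∑ a, η a * volCoef a = ∑ i, η (Sum.inr i) * sigma i := by
  rw [Fintype.sum_sum_type]
  simp [volCoef]

lemma extD_basisForm (a : Idx n) (y : E n) :
    extD (fun _ => basisForm a) y = ⟨0, 0, -volCoef a⟩ := by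
  have h : ∀ b c : Idx n, dCoef b (fun _ : E n => basisForm a c) y = 0 := by
    intro b c
    rw [dCoef_const]
    by_cases hc : c = a
    · simpa [basisForm, hc] using constD_smul_one (n := n) 1 b
    · simpa [basisForm, hc] using constD_smul_one (n := n) 0 b
  ext : 1
  · funext μ ν; simp [extD, wedge, h]
  · funext μ i; simp [extD, wedge, h]
  · simp only [extD, wedge, h, sum_basisForm_mul_sigma]
    simp

/-- Torsion is left linear: the derivative terms of `∇` and `d` agree after the wedge, so testing on
the basis suffices. -/
theorem torsionFree_iff {U : Set (E n)} {N : ThreeTensor n} :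
    (∀ η, SmoothForm U η → ∀ y ∈ U, wedge (nabla N η y) = extD η y) ↔
      ∀ y ∈ U, ∀ a, wedge (N y a) = ⟨0, 0, -volCoef a⟩ := by
  constructor
  · intro H y hy a
    have := H _ (smoothForm_basisForm U a) y hy
    rwa [nabla_basisForm, extD_basisForm] at this
  · intro H η _ y hy
    have h := fun a => TwoForm.ext_iff.1 (H y hy a)
    simp only [wedge] at h
    ext : 1
    · funext μ ν
      have h1 := fun a => congrFun (congrFun (h a).1 μ) ν
      simp only [Pi.zero_apply, sub_eq_zero] at h1
      simp [wedge, extD, nabla, h1]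
    · funext μ i
      have h1 := fun a => congrFun (congrFun (h a).2.1 μ) i
      simp only [Pi.zero_apply, sub_eq_zero] at h1
      simp [wedge, extD, nabla, h1]
    · have h1 := fun a => (h a).2.2
      simp only [wedge, extD, nabla]
      rw [← sum_mul_volCoef, sub_eq_add_neg, ← Finset.sum_neg_distrib]
      simp only [← mul_neg, ← h1, mul_smul_comm, mul_add, Finset.sum_add_distrib, smul_add,
        Finset.smul_sum]
      abel

/-- The torsion-free condition on the coefficients of `connOf`. -/
structure TorsionFreeCoef (nn : Idx n → Idx n → Idx n → ℂ)
    (mm : Fin 2 → Fin 2 → Idx n → Idx n → ℂ) : Prop where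
  nn_dd : ∀ a μ ν, nn a (Sum.inl μ) (Sum.inl ν) = nn a (Sum.inl ν) (Sum.inl μ)
  nn_ds : ∀ a μ i, nn a (Sum.inl μ) (Sum.inr i) = nn a (Sum.inr i) (Sum.inl μ)
  nn_ss : ∀ a, nn a (Sum.inr 0) (Sum.inr 0) + nn a (Sum.inr 1) (Sum.inr 1) = 0
  mm_dd : ∀ p k μ ν, mm p k (Sum.inl μ) (Sum.inl ν) = mm p k (Sum.inl ν) (Sum.inl μ)
  mm_ds : ∀ p k μ i, mm p k (Sum.inl μ) (Sum.inr i) = mm p k (Sum.inr i) (Sum.inl μ)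
  mm_ss : ∀ p k, mm p k (Sum.inr 0) (Sum.inr 0) + mm p k (Sum.inr 1) (Sum.inr 1)
    = if p = k then Complex.I else 0

lemma I_smul_eq_neg_iff {x v : Mat} : Complex.I • x = -v ↔ x = Complex.I • v := by
  constructor
  · intro h
    have := congrArg (fun z => -Complex.I • z) h
    simpa [smul_smul] using this
  · rintro rfl
    simp [smul_smul]

lemma torsionFreeCoef_iff {nn : Idx n → Idx n → Idx n → ℂ}
    {mm : Fin 2 → Fin 2 → Idx n → Idx n → ℂ} :
    (∀ a, wedge (connOf nn mm a) = ⟨0, 0, -volCoef a⟩) ↔ TorsionFreeCoef nn mm := by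
  have hvol : ∀ k : Fin 2, Complex.I • volCoef (Sum.inr k : Idx n)
      = (0 : ℂ) • (1 : Mat) + ∑ p, (if p = k then Complex.I else 0) • sigma p := by
    intro k; simp [volCoef]
  have hadd : ∀ (k : Fin 2) (b c b' c' : Idx n),
      connOf nn mm (Sum.inr k) b c + connOf nn mm (Sum.inr k) b' c'
      = (nn (Sum.inr k) b c + nn (Sum.inr k) b' c') • (1 : Mat)
        + ∑ p, (mm p k b c + mm p k b' c') • sigma p := by
    intro k b c b' c'
    simp only [connOf, add_smul, Finset.sum_add_distrib]
    abel
  constructor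
  · intro H
    have h := fun a => TwoForm.ext_iff.1 (H a)
    simp only [wedge, I_smul_eq_neg_iff] at h
    have h1 := fun a μ ν => congrFun (congrFun (h a).1 μ) ν
    have h2 := fun a μ i => congrFun (congrFun (h a).2.1 μ) i
    have h3 := fun a => (h a).2.2
    simp only [Pi.zero_apply, sub_eq_zero] at h1 h2
    have h1' := fun k μ ν => pauli_ext_iff.1 (h1 (Sum.inr k) μ ν)
    have h2' := fun k μ i => pauli_ext_iff.1 (h2 (Sum.inr k) μ i)
    have h3' := fun k => pauli_ext_iff.1 ((hadd k _ _ _ _).symm.trans ((h3 (Sum.inr k)).trans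
      (hvol k)))
    refine ⟨?_, ?_, ?_, fun p k μ ν => (h1' k μ ν).2 p, fun p k μ i => (h2' k μ i).2 p,
      fun p k => (h3' k).2 p⟩
    · rintro (l | k) μ ν
      · exact smul_one_inj.1 (h1 (Sum.inl l) μ ν)
      · exact (h1' k μ ν).1
    · rintro (l | k) μ i
      · exact smul_one_inj.1 (h2 (Sum.inl l) μ i)
      · exact (h2' k μ i).1
    · rintro (l | k)
      · have := h3 (Sum.inl l)
        simpa [connOf, volCoef, ← add_smul] using this
      · exact (h3' k).1
  · intro H a
    ext : 1
    · funext μ ν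
      rcases a with l | k
      · simp [wedge, connOf, H.nn_dd _ μ ν]
      · simp [wedge, connOf, H.nn_dd _ μ ν, H.mm_dd _ _ μ ν]
    · funext μ i
      rcases a with l | k
      · simp [wedge, connOf, H.nn_ds _ μ i]
      · simp only [wedge, connOf, H.nn_ds _ μ i, H.mm_ds _ _ μ i, sub_self, Pi.zero_apply]
    · simp only [wedge, I_smul_eq_neg_iff]
      rcases a with l | k
      · simp only [connOf, volCoef, ← add_smul, H.nn_ss]
        simp
      · rw [hvol, hadd, H.nn_ss]
        simp only [H.mm_ss]

/-! ### Metric compatibility -/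

lemma sum_smul_connOf (nn : Idx n → Idx n → Idx n → ℂ)
    (mm : Fin 2 → Fin 2 → Idx n → Idx n → ℂ) (w : Idx n → ℂ) (b c : Idx n) :
    ∑ a, w a • connOf nn mm a b c = (∑ a, w a * nn a b c) • (1 : Mat)
      + ∑ p, (∑ k, w (Sum.inr k) * mm p k b c) • sigma p := by
  simp only [Fintype.sum_sum_type, connOf, smul_smul, smul_add, Finset.sum_add_distrib, add_smul,
    Finset.sum_smul, Finset.smul_sum]
  rw [Finset.sum_comm (f := fun p k => (w (Sum.inr k) * mm p k b c) • sigma p)]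
  abel

/-- Separates the flip from the correction, which sees only the `s^k ⊗ s^i` components. -/
lemma sum_mul_braidOf (mm : Fin 2 → Fin 2 → Idx n → Idx n → ℂ) (K : Idx n → Idx n → Mat)
    (c d : Idx n) :
    ∑ a, ∑ e, K a e * (braidOf mm a e c d • 1)
      = K d c + ∑ k, ∑ i, (2 * Complex.I * mm i k c d) • K (Sum.inr k) (Sum.inr i) := by
  have h : ∀ a e, K a e * (braidOf mm a e c d • (1 : Mat))
      = (if c = e then if d = a then K a e else 0 else 0)
        + (match a, e with
          | Sum.inr k, Sum.inr i => (2 * Complex.I * mm i k c d) • K a e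
          | _, _ => 0) := by
    rintro (μ | k) (ν | i) <;>
      simp [braidOf, add_smul, mul_add, ← ite_and]
  simp only [h, Finset.sum_add_distrib]
  congr 1
  · rw [Finset.sum_comm]
    simp
  · simp [Fintype.sum_sum_type]

/-- Metric compatibility in terms of the coefficients of `connOf`; here `dG c d b` is the
derivative in the direction `c` of the coefficient `G d b` of the metric. -/
structure CompatAt (G : Idx n → Idx n → ℂ) (dG : Idx n → Idx n → Idx n → ℂ)
    (nn : Idx n → Idx n → Idx n → ℂ) (mm : Fin 2 → Fin 2 → Idx n → Idx n → ℂ) : Prop where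
  scalar : ∀ c d b, dG c d b + ∑ a, G a b * nn a c d + ∑ a, G d a * nn a c b
    + ∑ k, ∑ i, 2 * Complex.I * mm i k c d * ∑ a, G (Sum.inr k) a * nn a (Sum.inr i) b = 0
  pauli : ∀ p c d b, ∑ k, G (Sum.inr k) b * mm p k c d + ∑ k, G d (Sum.inr k) * mm p k c b
    + ∑ k, ∑ i, 2 * Complex.I * mm i k c d
      * ∑ l, G (Sum.inr k) (Sum.inr l) * mm p l (Sum.inr i) b = 0

/-- The metric and the braiding have scalar coefficients, so no product of two Pauli matrices arises
and each component lies in the span of `1, σ¹, σ²`. -/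
lemma nabla2_eq_zero_iff {G : E n → Idx n → Idx n → ℂ} {N : ThreeTensor n}
    {S : E n → Idx n → Idx n → Idx n → Idx n → Mat} {y : E n} {nn : Idx n → Idx n → Idx n → ℂ}
    {mm : Fin 2 → Fin 2 → Idx n → Idx n → ℂ} (hN : N y = connOf nn mm)
    (hS : S y = fun a b c d => braidOf mm a b c d • 1) :
    nabla2 N S (fun z a b => G z a b • 1) y = 0 ↔
      CompatAt (G y) (fun c d b => scalarD (fun z => G z d b) y c) nn mm := by
  have key : ∀ c d b, nabla2 N S (fun z a b => G z a b • 1) y c d b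
      = (scalarD (fun z => G z d b) y c + ∑ a, G y a b * nn a c d + ∑ a, G y d a * nn a c b
        + ∑ k, ∑ i, 2 * Complex.I * mm i k c d
          * ∑ a, G y (Sum.inr k) a * nn a (Sum.inr i) b) • (1 : Mat)
      + ∑ p, (∑ k, G y (Sum.inr k) b * mm p k c d + ∑ k, G y d (Sum.inr k) * mm p k c b
        + ∑ k, ∑ i, 2 * Complex.I * mm i k c d
          * ∑ l, G y (Sum.inr k) (Sum.inr l) * mm p l (Sum.inr i) b) • sigma p := by
    intro c d b
    simp only [nabla2, nabla, hN, hS, smul_mul_assoc, one_mul, sum_smul_connOf, dCoef_smul_one,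
      sum_mul_braidOf]
    simp only [Fin.sum_univ_two (f := fun p : Fin 2 => _ • sigma p),
      Fin.sum_univ_two (f := fun k : Fin 2 => Finset.sum (Finset.univ : Finset (Fin 2)) _)]
    simp only [Fin.sum_univ_two]
    module
  constructor
  · intro H
    have h : ∀ c d b, _ := fun c d b => pauli_eq_zero_iff.1
      ((key c d b).symm.trans (congrFun (congrFun (congrFun H c) d) b))
    exact ⟨fun c d b => (h c d b).1, fun p c d b => (h c d b).2 p⟩
  · intro H
    funext c d b
    rw [key]
    exact pauli_eq_zero_iff.2 ⟨H.scalar c d b, fun p => H.pauli p c d b⟩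

/-! ### The `*`-preserving condition -/

/-- The `*`-preserving condition in terms of the coefficients of `connOf`. -/
structure StarAt (nn : Idx n → Idx n → Idx n → ℂ)
    (mm : Fin 2 → Fin 2 → Idx n → Idx n → ℂ) : Prop where
  scalar : ∀ a b c, nn a b c = star (nn a b c)
    + ∑ k, ∑ i, 2 * Complex.I * mm i k b c * star (nn a (Sum.inr i) (Sum.inr k))
  pauli : ∀ p l b c, mm p l b c = star (mm p l b c)
    + ∑ k, ∑ i, 2 * Complex.I * mm i k b c * star (mm p l (Sum.inr i) (Sum.inr k))

lemma connOf_conjTranspose (nn : Idx n → Idx n → Idx n → ℂ)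
    (mm : Fin 2 → Fin 2 → Idx n → Idx n → ℂ) (a b c : Idx n) :
    (connOf nn mm a b c)ᴴ
      = connOf (fun a b c => star (nn a b c)) (fun p k b c => star (mm p k b c)) a b c := by
  rcases a with μ | k
  · simp [connOf]
  · simp [connOf, sigma_conjTranspose]

lemma starAt_iff {nn : Idx n → Idx n → Idx n → ℂ} {mm : Fin 2 → Fin 2 → Idx n → Idx n → ℂ} :
    (∀ a b c, connOf nn mm a b c
      = ∑ c', ∑ d, (connOf nn mm a d c')ᴴ * (braidOf mm c' d b c • (1 : Mat))) ↔
      StarAt nn mm := by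
  have key : ∀ l b c, ∑ c', ∑ d, (connOf nn mm (Sum.inr l) d c')ᴴ
        * (braidOf mm c' d b c • (1 : Mat))
      = (star (nn (Sum.inr l) b c) + ∑ k, ∑ i, 2 * Complex.I * mm i k b c
          * star (nn (Sum.inr l) (Sum.inr i) (Sum.inr k))) • (1 : Mat)
        + ∑ p, (star (mm p l b c) + ∑ k, ∑ i, 2 * Complex.I * mm i k b c
          * star (mm p l (Sum.inr i) (Sum.inr k))) • sigma p := by
    intro l b c
    rw [sum_mul_braidOf mm fun c' d => (connOf nn mm (Sum.inr l) d c')ᴴ]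
    simp only [connOf_conjTranspose]
    simp only [connOf, Fin.sum_univ_two]
    module
  have key' : ∀ μ b c, ∑ c', ∑ d, (connOf nn mm (Sum.inl μ) d c')ᴴ
        * (braidOf mm c' d b c • (1 : Mat))
      = (star (nn (Sum.inl μ) b c) + ∑ k, ∑ i, 2 * Complex.I * mm i k b c
          * star (nn (Sum.inl μ) (Sum.inr i) (Sum.inr k))) • (1 : Mat) := by
    intro μ b c
    rw [sum_mul_braidOf mm fun c' d => (connOf nn mm (Sum.inl μ) d c')ᴴ]
    simp only [connOf_conjTranspose]
    simp only [connOf, Fin.sum_univ_two]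
    module
  constructor
  · intro H
    have h : ∀ l b c, _ := fun l b c => pauli_ext_iff.1 ((H (Sum.inr l) b c).trans (key l b c))
    refine ⟨?_, fun p l b c => (h l b c).2 p⟩
    rintro (μ | l) b c
    · exact smul_one_inj.1 ((H (Sum.inl μ) b c).trans (key' μ b c))
    · exact (h l b c).1
  · rintro H (μ | l) b c
    · rw [key', ← H.scalar]
      rfl
    · rw [key]
      exact pauli_ext_iff.2 ⟨H.scalar _ b c, fun p => H.pauli p l b c⟩

lemma SmoothForm.starForm {U : Set (E n)} {η : OneForm n} (h : SmoothForm U η) :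
    SmoothForm U (starForm η) := by
  intro a i j
  exact (Complex.conjCLE.contDiff (n := ∞)).comp_contDiffOn (h a j i)

/-- The `e^a` are central and self-adjoint, so `η* = e^a η_a*`. Expanding `∇` of this by the right
Leibniz rule, the derivative terms match those of `σ † ∇ η`; what is left is the defect on `e^a`
times `η_a*`, and the condition need only be tested on the basis. -/
theorem starPreserving_iff {U : Set (E n)} {N : ThreeTensor n}
    {S : E n → Idx n → Idx n → Idx n → Idx n → Mat} {nn : E n → Idx n → Idx n → Idx n → ℂ}
    {mm : E n → Fin 2 → Fin 2 → Idx n → Idx n → ℂ}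
    (hN : ∀ y ∈ U, N y = connOf (nn y) (mm y))
    (hS : ∀ y ∈ U, S y = fun a b c d => braidOf (mm y) a b c d • 1) :
    StarPreserving U N S ↔ ∀ y ∈ U, StarAt (nn y) (mm y) := by
  -- the value of `σ ∘ † ∘ ∇` on a form, up to the `*`-preserving condition on the basis
  have hbraid : ∀ (η : OneForm n), ∀ y ∈ U, ∀ b c,
      braid S (dagger (nabla N η)) y b c = nabla N (starForm η) y b c
        + ∑ a, (∑ c', ∑ d, (N y a d c')ᴴ * S y c' d b c - N y a b c) * (η y a)ᴴ := by
    intro η y hy b c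
    have hL : ∀ a, (η y a)ᴴ * N y a b c + (if c = a then dCoef b (fun z => (η z a)ᴴ) y else 0)
        = N y a b c * (η y a)ᴴ + ∑ d, dCoef d (fun z => (η z a)ᴴ) y * S y a d b c := by
      intro a
      rw [hN y hy, hS y hy]
      exact leibnizAt_connOf (nn y) (mm y) (F := fun b => dCoef b (fun z => (η z a)ᴴ) y)
        (m := (η y a)ᴴ) (fun i => rfl) a b c
    have hL' := Finset.sum_congr rfl fun a (_ : a ∈ (Finset.univ : Finset (Idx n))) => hL a
    rw [Finset.sum_add_distrib, Finset.sum_add_distrib, Finset.sum_ite_eq] at hL'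
    simp only [Finset.mem_univ, if_true] at hL'
    have hcomm : ∀ a c' d, (N y a d c')ᴴ * (η y a)ᴴ * S y c' d b c
        = (N y a d c')ᴴ * S y c' d b c * (η y a)ᴴ := by
      intro a c' d
      rw [hS y hy]
      simp
    have e1 : braid S (dagger (nabla N η)) y b c
        = ∑ c', ∑ d, dCoef d (fun z => (η z c')ᴴ) y * S y c' d b c
          + ∑ a, (∑ c', ∑ d, (N y a d c')ᴴ * S y c' d b c) * (η y a)ᴴ := by
      have e2 : ∀ a, (∑ c', ∑ d, (N y a d c')ᴴ * S y c' d b c) * (η y a)ᴴ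
          = ∑ c', ∑ d, (N y a d c')ᴴ * (η y a)ᴴ * S y c' d b c := by
        intro a
        simp only [Finset.sum_mul, hcomm]
      simp only [e2]
      rw [Finset.sum_comm (f := fun a c' => ∑ d, (N y a d c')ᴴ * (η y a)ᴴ * S y c' d b c),
        ← Finset.sum_add_distrib]
      refine Finset.sum_congr rfl fun c' _ => ?_
      rw [Finset.sum_comm (f := fun a d => (N y a d c')ᴴ * (η y a)ᴴ * S y c' d b c),
        ← Finset.sum_add_distrib]
      refine Finset.sum_congr rfl fun d _ => ?_
      simp only [dagger, nabla, Matrix.conjTranspose_add, Matrix.conjTranspose_sum,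
        Matrix.conjTranspose_mul, dCoef_conjTranspose, add_mul, Finset.sum_mul]
    rw [e1]
    simp only [sub_mul, Finset.sum_sub_distrib, nabla, starForm]
    linear_combination (norm := abel) -hL'
  constructor
  · intro H y hy
    refine starAt_iff.1 fun a b c => ?_
    have h1 := congrFun (congrFun (H _ (smoothForm_basisForm U a) y hy) b) c
    rw [hbraid _ y hy, left_eq_add] at h1
    have h2 : ∀ a', (basisForm a a')ᴴ = basisForm a a' := by
      intro a'
      by_cases h : a' = a <;> simp [basisForm, h]
    simp only [h2] at h1
    simp only [basisForm, mul_ite, mul_one, mul_zero, Finset.sum_ite_eq', Finset.mem_univ,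
      if_true, sub_eq_zero] at h1
    rw [hN y hy, hS y hy] at h1
    exact h1.symm
  · intro H η _ y hy
    funext b c
    rw [hbraid η y hy]
    have h := fun a => sub_eq_zero.2 (starAt_iff.2 (H y hy) a b c).symm
    rw [hN y hy, hS y hy]
    simp only [h, zero_mul, Finset.sum_const_zero, add_zero]

/-! ### Quantum Levi-Civita connections -/

/-- The coefficients of a quantum Levi-Civita connection at a point. -/
structure PointQLC (G : Idx n → Idx n → ℂ) (dG : Idx n → Idx n → Idx n → ℂ)
    (N : Idx n → Idx n → Idx n → Mat) (nn : Idx n → Idx n → Idx n → ℂ)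
    (mm : Fin 2 → Fin 2 → Idx n → Idx n → ℂ) : Prop where
  conn : N = connOf nn mm
  torsion : TorsionFreeCoef nn mm
  compat : CompatAt G dG nn mm

/-- No regularity is imposed on the braiding, and the conditions on it are pointwise, so it may be
chosen separately at each point. -/
theorem exists_isQLC_iff {U : Set (E n)} (hU : IsOpen U) {G : E n → Idx n → Idx n → ℂ}
    {N : ThreeTensor n} :
    (∃ S, FlipAssumption U S ∧ IsQLC U (fun z a b => G z a b • 1) N S) ↔
      ∀ y ∈ U, ∃ nn mm,
        PointQLC (G y) (fun c d b => scalarD (fun z => G z d b) y c) (N y) nn mm := by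
  classical
  constructor
  · rintro ⟨S, hflip, hb, ht, hc⟩ y hy
    obtain ⟨nn, mm, hN, hS⟩ := (isBimoduleConnection_flip_iff hU).1 ⟨hb, hflip⟩ y hy
    refine ⟨nn, mm, hN, torsionFreeCoef_iff.1 ?_, (nabla2_eq_zero_iff hN hS).1 (hc y hy)⟩
    rw [← hN]
    exact torsionFree_iff.1 ht y hy
  · intro H
    choose! nn mm H using H
    have hb := (isBimoduleConnection_flip_iff hU (N := N)
      (S := fun y a b c d => braidOf (mm y) a b c d • 1)).2
      fun y hy => ⟨nn y, mm y, (H y hy).conn, rfl⟩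
    refine ⟨_, hb.2, hb.1, torsionFree_iff.2 fun y hy => ?_, fun y hy => ?_⟩
    · rw [(H y hy).conn]
      exact torsionFreeCoef_iff.2 (H y hy).torsion
    · exact (nabla2_eq_zero_iff (H y hy).conn rfl).2 (H y hy).compat

theorem exists_isStarQLC_iff {U : Set (E n)} (hU : IsOpen U) {G : E n → Idx n → Idx n → ℂ}
    {N : ThreeTensor n} :
    (∃ S, FlipAssumption U S ∧ IsQLC U (fun z a b => G z a b • 1) N S ∧ StarPreserving U N S) ↔
      ∀ y ∈ U, ∃ nn mm,
        PointQLC (G y) (fun c d b => scalarD (fun z => G z d b) y c) (N y) nn mm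
          ∧ StarAt nn mm := by
  classical
  constructor
  · rintro ⟨S, hflip, ⟨hb, ht, hc⟩, hstar⟩
    have h := (isBimoduleConnection_flip_iff hU).1 ⟨hb, hflip⟩
    choose! nn mm hN hS using h
    intro y hy
    refine ⟨nn y, mm y, ⟨hN y hy, torsionFreeCoef_iff.1 ?_,
      (nabla2_eq_zero_iff (hN y hy) (hS y hy)).1 (hc y hy)⟩,
      (starPreserving_iff hN hS).1 hstar y hy⟩
    rw [← hN y hy]
    exact torsionFree_iff.1 ht y hy
  · intro H
    choose! nn mm H using H
    have hb := (isBimoduleConnection_flip_iff hU (N := N)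
      (S := fun y a b c d => braidOf (mm y) a b c d • 1)).2
      fun y hy => ⟨nn y, mm y, (H y hy).1.conn, rfl⟩
    refine ⟨_, hb.2, ⟨hb.1, torsionFree_iff.2 fun y hy => ?_, fun y hy => ?_⟩,
      (starPreserving_iff (fun y hy => (H y hy).1.conn) fun y _ => rfl).2
        fun y hy => (H y hy).2⟩
    · rw [(H y hy).1.conn]
      exact torsionFreeCoef_iff.2 (H y hy).1.torsion
    · exact (nabla2_eq_zero_iff (H y hy).1.conn rfl).2 (H y hy).1.compat

end Pointwise

/-! ### Pointwise algebra for general parameters: the dichotomy and the direct sum solutions. -/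

section Algebra

variable {n : ℕ}

/-- The derivative of `metricCoef g A h`, given those of `g`, `A`, `h`. -/
def dMetric (dg : Fin n → Fin n → Fin n → ℂ) (dA : Fin n → Fin 2 → Fin n → ℂ) (dh : Fin n → ℂ) :
    Idx n → Idx n → Idx n → ℂ
  | Sum.inl μ, d, b => metricCoef (dg μ) (dA μ) (dh μ) d b
  | Sum.inr _, _, _ => 0

lemma scalarD_metricCoef (g : E n → Fin n → Fin n → ℂ) (A : E n → Fin 2 → Fin n → ℂ) (h : E n → ℂ)
    (y : E n) (hh : DifferentiableAt ℝ h y) (c d b : Idx n) :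
    scalarD (fun z => metricCoef (g z) (A z) (h z) d b) y c
      = dMetric (fun μ α β => pd μ (fun z => g z α β) y) (fun μ i α => pd μ (fun z => A z i α) y)
          (fun μ => pd μ h y) c d b := by
  rcases c with μ | k
  · rcases d with α | i <;> rcases b with β | j
    · rfl
    · rfl
    · rfl
    · simp only [scalarD, dMetric, metricCoef]
      rw [pd_mul _ hh (differentiableAt_const _), pd_const]
      ring
  · rfl

lemma gamma_eq_connOf (u v ρ : ℂ) (k i j : Fin 2) :
    gamma u v ρ k i j = (0 : ℂ) • (1 : Mat) + ∑ p, gammaCoef u v ρ k i j p • sigma p := by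
  simp [gamma]

/-! ### The two cases for the mixed part of the metric -/

section TwoCases

variable {g : Fin n → Fin n → ℂ} {A : Fin 2 → Fin n → ℂ} {h u v ρ : ℂ}
  {dG : Idx n → Idx n → Idx n → ℂ} {nn : Idx n → Idx n → Idx n → ℂ}
  {mm : Fin 2 → Fin 2 → Idx n → Idx n → ℂ}

/-- A condition on `A` and the inner connection alone: the Pauli equation for `(s^i, dx^μ, s^j)`
after the mixed coefficients have been eliminated. -/
lemma inner_relation (H : CompatAt (metricCoef g A h) dG nn mm) (T : TorsionFreeCoef nn mm)
    (hγ : ∀ p k i j, mm p k (Sum.inr i) (Sum.inr j) = gammaCoef u v ρ k i j p)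
    (μ : Fin n) (i j p : Fin 2) :
    ∑ k, A k μ * gammaCoef u v ρ k j i p + ∑ k, A k μ * gammaCoef u v ρ k i j p
      + 2 * Complex.I * ∑ l, ∑ m, gammaCoef u v ρ l m j p
        * ∑ k, A k μ * gammaCoef u v ρ k l i m = 0 := by
  -- The triples `(s^i, dx^μ, s^j)` and `(dx^μ, s^i, s^j)` have the same quadratic term by torsion
  -- freeness; their difference expresses the mixed coefficients through `A`.
  have hx : ∀ i j p, ∑ k, A k μ * gammaCoef u v ρ k i j p
      = h * ![1, -1] i * mm p i (Sum.inr j) (Sum.inl μ) := by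
    intro i j p
    have e2 := H.pauli p (Sum.inr i) (Sum.inl μ) (Sum.inr j)
    have e3 := H.pauli p (Sum.inl μ) (Sum.inr i) (Sum.inr j)
    simp only [T.mm_ds] at e3
    simp only [metricCoef, hγ] at e2 e3
    have e4 : ∑ k, h * Matrix.diagonal ![1, -1] i k * mm p k (Sum.inr j) (Sum.inl μ)
        = h * ![1, -1] i * mm p i (Sum.inr j) (Sum.inl μ) := by
      simp [Matrix.diagonal_apply]
    rw [← e4]
    linear_combination e2 - e3
  have e2 := H.pauli p (Sum.inr i) (Sum.inl μ) (Sum.inr j)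
  simp only [metricCoef, hγ] at e2
  have e3 := hx i j p
  simp only [hx]
  simp only [Fin.sum_univ_two] at e2 e3 ⊢
  fin_cases j <;> simp at e2 e3 ⊢ <;> linear_combination e2 - e3

/-- `L1` and `L2` form a homogeneous system for `(A_1, A_2)` with determinant `-4((u-1)(v-1)+ρ²)`.
The equations `Q1` and `Q2` say that this determinant kills `A`. -/
theorem two_cases (hρ : ρ ≠ 0) (H : CompatAt (metricCoef g A h) dG nn mm)
    (T : TorsionFreeCoef nn mm)
    (hγ : ∀ p k i j, mm p k (Sum.inr i) (Sum.inr j) = gammaCoef u v ρ k i j p) :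
    (∀ i μ, A i μ = 0) ∨
      ((∀ μ, (v + ρ - 1) * A 0 μ = Complex.I * (v - ρ - 1) * A 1 μ) ∧
        (u - 1) * (v - 1) = -ρ ^ 2) := by
  have hI := Complex.I_sq
  have k := fun μ i j p => inner_relation H T hγ μ i j p
  have I3 : Complex.I ^ 3 = -Complex.I := Complex.I_pow_three
  have I4 : Complex.I ^ 4 = 1 := Complex.I_pow_four
  have L1 : ∀ μ, (u - v - 2 * ρ) * A 0 μ + Complex.I * (u + v - 2) * A 1 μ = 0 := by
    intro μ
    have k1 := k μ 0 0 1
    have k2 := k μ 0 1 0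
    simp [Fin.sum_univ_two, gammaCoef] at k1 k2
    linear_combination (norm := skip) 2 * k2 - 2 * k1
    field_simp
    ring_nf
  have L2 : ∀ μ, -Complex.I * (u + v - 2) * A 0 μ + (u - v + 2 * ρ) * A 1 μ = 0 := by
    intro μ
    have k1 := k μ 0 0 0
    have k2 := k μ 1 0 1
    simp [Fin.sum_univ_two, gammaCoef] at k1 k2
    linear_combination (norm := skip) 2 * k1 - 2 * k2
    field_simp
    ring_nf
    simp only [hI, I3]
    ring
  have Q1 : ∀ μ, ((u - 1) * (v - 1) + ρ ^ 2) * A 0 μ = 0 := by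
    intro μ
    have k1 := k μ 0 1 1
    have k2 := k μ 0 0 0
    simp [Fin.sum_univ_two, gammaCoef] at k1 k2
    linear_combination (norm := skip) (-Complex.I / 2) * (k1 + k2 + L2 μ / 2)
    field_simp
    ring_nf
    simp only [hI, I4]
    ring
  have Q2 : ∀ μ, ((u - 1) * (v - 1) + ρ ^ 2) * A 1 μ = 0 := by
    intro μ
    have k1 := k μ 1 0 0
    have k2 := k μ 0 0 1
    simp [Fin.sum_univ_two, gammaCoef] at k1 k2
    linear_combination (norm := skip) (-Complex.I / 2) * (k1 + k2 - L1 μ / 2)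
    field_simp
    ring_nf
    simp only [hI, I3, I4]
    ring
  by_cases hQ : (u - 1) * (v - 1) + ρ ^ 2 = 0
  · refine Or.inr ⟨fun μ => ?_, by linear_combination hQ⟩
    -- The combination of the two rows that eliminates `u`.
    linear_combination (Complex.I / 2) * L2 μ - L1 μ / 2 + (u + v - 2) / 2 * A 0 μ * hI
  · refine Or.inl fun i μ => ?_
    fin_cases i
    · exact (mul_eq_zero.1 (Q1 μ)).resolve_left hQ
    · exact (mul_eq_zero.1 (Q2 μ)).resolve_left hQ

end TwoCases

/-! ### The direct sum of a classical and a finite geometry -/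

/-- Compatibility of the inner connection with the finite metric, divided by `h`: sixteen rational
identities in `u, v, ρ`, checked one by one. -/
lemma gammaCoef_compat {u v ρ : ℂ} (hρ : ρ ≠ 0) (p i j l : Fin 2) :
    ![1, -1] l * gammaCoef u v ρ l i j p + ![1, -1] j * gammaCoef u v ρ j i l p
      + 2 * Complex.I * ∑ k, ∑ m, gammaCoef u v ρ k i j m
        * (![1, -1] k * gammaCoef u v ρ k m l p) = 0 := by
  have hI := Complex.I_sq
  have I3 : Complex.I ^ 3 = -Complex.I := Complex.I_pow_three
  fin_cases p <;> fin_cases i <;> fin_cases j <;> fin_cases l <;>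
    simp [Fin.sum_univ_two, gammaCoef] <;> field_simp <;> ring_nf <;>
    simp only [hI, I3] <;> ring

lemma gammaCoef_torsion (u v ρ : ℂ) (k p : Fin 2) :
    gammaCoef u v ρ k 0 0 p + gammaCoef u v ρ k 1 1 p = if p = k then Complex.I else 0 := by
  fin_cases k <;> fin_cases p <;> simp [gammaCoef]
  all_goals
    field_simp
    ring

/-- The scalar part of `directSumConn`. -/
def directSumN (Γ : Fin n → Fin n → Fin n → ℂ) : Idx n → Idx n → Idx n → ℂ
  | Sum.inl μ, Sum.inl α, Sum.inl β => -Γ μ α β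
  | _, _, _ => 0

/-- The `σ^p`-part of `directSumConn`. -/
def directSumM (γ : Fin 2 → Fin 2 → Fin 2 → Fin 2 → ℂ) : Fin 2 → Fin 2 → Idx n → Idx n → ℂ
  | p, k, Sum.inr i, Sum.inr j => γ k i j p
  | _, _, _, _ => 0

lemma directSumConn_eq_connOf (Γ : Fin n → Fin n → Fin n → ℂ) (u v ρ : ℂ) :
    directSumConn Γ (gamma u v ρ) = connOf (directSumN Γ) (directSumM (gammaCoef u v ρ)) := by
  funext a b c
  rcases a with μ | k <;> rcases b with α | i <;> rcases c with β | j <;>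
    simp [directSumConn, connOf, directSumN, directSumM, gamma]

/-- The blocks decouple: the Pauli part lives on the inner block and the scalar part on the `dx^μ`.
The scalar equations are those of the classical connection, the Pauli equations are
`gammaCoef_compat`. -/
theorem pointQLC_directSum {u v ρ : ℂ} (hρ : ρ ≠ 0) {Γ : Fin n → Fin n → Fin n → ℂ}
    (hΓ : ∀ μ α β, Γ μ α β = Γ μ β α) {g : Fin n → Fin n → ℂ} {h : ℂ}
    {dg : Fin n → Fin n → Fin n → ℂ}
    (hg : ∀ α β ν, dg α β ν - ∑ μ, Γ μ α β * g μ ν - ∑ μ, Γ μ α ν * g β μ = 0) :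
    PointQLC (metricCoef g 0 h) (dMetric dg 0 0) (directSumConn Γ (gamma u v ρ)) (directSumN Γ)
      (directSumM (gammaCoef u v ρ)) := by
  refine ⟨directSumConn_eq_connOf Γ u v ρ, ⟨?_, ?_, ?_, ?_, ?_, ?_⟩, ?_, ?_⟩
  · rintro (l | k) μ ν
    · simp [directSumN, hΓ l μ ν]
    · rfl
  · rintro (l | k) μ i <;> rfl
  · rintro (l | k) <;> simp [directSumN]
  · intro p k μ ν; rfl
  · intro p k μ i; rfl
  · intro p k
    exact gammaCoef_torsion u v ρ k p
  · rintro (μ | k) (α | i) (β | j)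
    · have := hg μ α β
      simp [dMetric, metricCoef, directSumN, directSumM, Fintype.sum_sum_type]
      simp only [mul_comm (g _ _)]
      linear_combination this
    all_goals simp [dMetric, metricCoef, directSumN, directSumM, Fintype.sum_sum_type]
  · rintro p (μ | i) (α | j) (β | l)
    all_goals try simp [metricCoef, directSumM]
    have := gammaCoef_compat (u := u) (v := v) hρ p i j l
    fin_cases j <;> fin_cases l <;> simp [Fin.sum_univ_two] at this ⊢ <;>
      linear_combination h * this

end Algebra

/-! ### The family member `u = 1 + ρ`, `v = 1 - ρ`: explicit solution, uniqueness and reality. -/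

section Solution

variable {n : ℕ}

/-- Since `u + v = 2`, the parameters become `a = i` and `c = 0`. Three entries survive, each with
`p = k`, and the braiding has diagonal entries `1 + 2i·i = -1` on `s^i ⊗ s^i`. -/
lemma gammaCoef_special {ρ : ℂ} (hρ : ρ ≠ 0) :
    gammaCoef (1 + ρ) (1 - ρ) ρ
      = ![![![![Complex.I, 0], ![0, 0]], ![![0, 0], ![0, 0]]],
          ![![![0, 0], ![0, -2 * ρ]], ![![0, 0], ![0, Complex.I]]]] := by
  simp only [gammaCoef]
  ring_nf
  simp [hρ]
  ring

/-- The metric contraction `G_{ab} w^b` for the metric `metricCoef g ![a, 0] h`. -/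
def lower (g : Fin n → Fin n → ℂ) (a : Fin n → ℂ) (h : ℂ) (w : Idx n → ℂ) : Idx n → ℂ
  | Sum.inl β => ∑ ν, g β ν * w (Sum.inl ν) + a β * w (Sum.inr 0)
  | Sum.inr i => ![∑ ν, a ν * w (Sum.inl ν) + h * w (Sum.inr 0), -h * w (Sum.inr 1)] i

lemma sum_metricCoef_mul (g : Fin n → Fin n → ℂ) (a : Fin n → ℂ) (h : ℂ) (w : Idx n → ℂ)
    (b : Idx n) : ∑ x, metricCoef g ![a, 0] h b x * w x = lower g a h w b := by
  rcases b with β | i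
  · simp [metricCoef, lower, Fintype.sum_sum_type]
  · fin_cases i <;> simp [metricCoef, lower, Fintype.sum_sum_type]

lemma sum_metricCoef_mul' {g : Fin n → Fin n → ℂ} (hg : ∀ μ ν, g μ ν = g ν μ) (a : Fin n → ℂ)
    (h : ℂ) (w : Idx n → ℂ) (b : Idx n) :
    ∑ x, metricCoef g ![a, 0] h x b * w x = lower g a h w b := by
  rw [← sum_metricCoef_mul]
  refine Finset.sum_congr rfl fun x _ => ?_
  congr 1
  rcases b with β | i <;> rcases x with ν | j
  · exact hg _ _
  · rfl
  · rfl
  · fin_cases i <;> fin_cases j <;> simp [metricCoef]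

/-- The scalar part of `solutionConn`, in terms of the fields `B` and `cl`. -/
def solutionN (a : Fin n → ℂ) (h : ℂ) (B : Fin 2 → Fin n → Fin n → ℂ) (cl : Fin n → ℂ)
    (Γ : Fin n → Fin n → Fin n → ℂ) (nA : Fin n → Fin n → ℂ) (C : Fin n → ℂ) :
    Idx n → Idx n → Idx n → ℂ :=
  let E : Fin 2 → Fin 2 → Fin n → ℂ := fun k i α =>
    ![![-(1 / h * ∑ μ, a μ * B 0 μ α), 1 / h * (cl α - ∑ μ, a μ * B 1 μ α)],
      ![1 / h * cl α, 0]] k i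
  fun a b c => match a, b, c with
  | Sum.inl μ, Sum.inl α, Sum.inl β => -Γ μ α β
  | Sum.inl μ, Sum.inl α, Sum.inr i => B i μ α
  | Sum.inl μ, Sum.inr i, Sum.inl α => B i μ α
  | Sum.inl μ, Sum.inr i, Sum.inr j => C μ * !![0, 1; -1, 0] i j
  | Sum.inr k, Sum.inl α, Sum.inl β => ![-(1 / (2 * h) * (nA α β + nA β α)), 0] k
  | Sum.inr k, Sum.inl α, Sum.inr i => E k i α
  | Sum.inr k, Sum.inr i, Sum.inl α => E k i α
  | Sum.inr _, Sum.inr _, Sum.inr _ => 0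

/-- The `σ^p`-part of `solutionConn`. -/
def solutionM (a : Fin n → ℂ) (h ρ : ℂ) : Fin 2 → Fin 2 → Idx n → Idx n → ℂ
  | p, k, Sum.inl α, Sum.inl β => if p = 0 ∧ k = 0 then Complex.I / h ^ 2 * (a α * a β) else 0
  | p, k, Sum.inl α, Sum.inr i => if p = 0 ∧ k = 0 ∧ i = 0 then Complex.I / h * a α else 0
  | p, k, Sum.inr i, Sum.inl α => if p = 0 ∧ k = 0 ∧ i = 0 then Complex.I / h * a α else 0
  | p, k, Sum.inr i, Sum.inr j => gammaCoef (1 + ρ) (1 - ρ) ρ k i j p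

lemma solutionConn_eq_connOf (g : Fin n → Fin n → ℂ) (a : Fin n → ℂ) (h ρ : ℂ)
    (Γ : Fin n → Fin n → Fin n → ℂ) (nA : Fin n → Fin n → ℂ) (C : Fin n → ℂ) :
    solutionConn g a h ρ Γ nA C = connOf
      (solutionN a h (bField (gTilde g a h) a h nA fun α => ∑ ν, g α ν * C ν)
        (fun α => ∑ ν, g α ν * C ν) Γ nA C) (solutionM a h ρ) := by
  funext x b c
  rcases x with μ | k <;> rcases b with α | i <;> rcases c with β | j
  · rfl
  · rfl
  · rfl
  · rfl
  · fin_cases k <;>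
      simp [solutionConn, connOf, solutionN, solutionM, dField]
    all_goals abel
  · fin_cases k <;> fin_cases j <;>
      simp [solutionConn, connOf, solutionN, solutionM, eField]
    all_goals abel
  · fin_cases k <;> fin_cases i <;>
      simp [solutionConn, connOf, solutionN, solutionM, eField]
    all_goals abel
  · simp [solutionConn, connOf, solutionN, solutionM, gamma]

/-- The tensorial equations of `Geometry.IsSolution` at a point. -/
structure PointSolution (g : Fin n → Fin n → ℂ) (a : Fin n → ℂ) (h : ℂ)
    (dg : Fin n → Fin n → Fin n → ℂ) (Γ : Fin n → Fin n → Fin n → ℂ) (nA : Fin n → Fin n → ℂ)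
    (C : Fin n → ℂ) : Prop where
  Γ_symm : ∀ μ α β, Γ μ α β = Γ μ β α
  covariant : ∀ μ σ ν, dg μ σ ν - ∑ l, Γ l μ σ * g l ν - ∑ l, Γ l μ ν * g σ l
    = 1 / (2 * h) * (a ν * (nA σ μ + nA μ σ) + a σ * (nA ν μ + nA μ ν))
  orthogonal : ∑ μ, a μ * C μ = 0

lemma gTilde_mulVec (g : Fin n → Fin n → ℂ) (a : Fin n → ℂ) (h : ℂ) (x : Fin n → ℂ) (β : Fin n) :
    (gTilde g a h *ᵥ x) β = ∑ ν, g β ν * x ν - a β / h * ∑ ν, a ν * x ν := by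
  have h3 : (gTilde g a h *ᵥ x) β = ∑ ν, (g β ν - a β * a ν / h) * x ν := rfl
  rw [h3, Finset.mul_sum, ← Finset.sum_sub_distrib]
  refine Finset.sum_congr rfl fun ν _ => ?_
  ring

/-- `g̃` is the Schur complement of `h` in the metric. Formulas with `g̃⁻¹` are thus traded for
linear equations in `g` and `a`, the form in which compatibility supplies them. -/
lemma eq_inv_mulVec_iff {g : Fin n → Fin n → ℂ} {a : Fin n → ℂ} {h : ℂ}
    (hdet : (gTilde g a h).det ≠ 0) (x w : Fin n → ℂ) :
    x = (gTilde g a h)⁻¹ *ᵥ w ↔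
      ∀ β, ∑ ν, g β ν * x ν = w β + a β / h * ∑ ν, a ν * x ν := by
  have hu := isUnit_iff_ne_zero.2 hdet
  constructor
  · intro hx β
    have h1 : gTilde g a h *ᵥ x = w := by
      rw [hx, Matrix.mulVec_mulVec, Matrix.mul_nonsing_inv _ hu, Matrix.one_mulVec]
    have h2 := congrFun h1 β
    rw [gTilde_mulVec] at h2
    linear_combination h2
  · intro H
    have h1 : gTilde g a h *ᵥ x = w := by
      funext β
      rw [gTilde_mulVec]
      linear_combination H β
    rw [← h1, Matrix.mulVec_mulVec, Matrix.nonsing_inv_mul _ hu, Matrix.one_mulVec]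

lemma bField_eq_mulVec (gt : Matrix (Fin n) (Fin n) ℂ) (a : Fin n → ℂ) (h : ℂ)
    (nA : Fin n → Fin n → ℂ) (cl : Fin n → ℂ) (i : Fin 2) (α : Fin n) :
    (fun μ => bField gt a h nA cl i μ α)
      = gt⁻¹ *ᵥ ![fun β => 1 / 2 * (nA β α - nA α β), fun β => -(1 / h) * a β * cl α] i := by
  funext μ
  fin_cases i
  · simp [bField, Matrix.mulVec, dotProduct, Finset.mul_sum]
    refine Finset.sum_congr rfl fun ν _ => ?_
    ring
  · simp [bField, Matrix.mulVec, dotProduct, Finset.mul_sum, Finset.sum_mul]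
    refine Finset.sum_congr rfl fun ν _ => ?_
    ring

section

variable {g : Fin n → Fin n → ℂ} {a : Fin n → ℂ} {h ρ : ℂ} {dg : Fin n → Fin n → Fin n → ℂ}
  {da : Fin n → Fin n → ℂ} {dh : Fin n → ℂ}

lemma solutionM_pauli (hh : h ≠ 0) (hρ : ρ ≠ 0) (p : Fin 2) (c d b : Idx n) :
    ∑ k, metricCoef g ![a, 0] h (Sum.inr k) b * solutionM a h ρ p k c d
      + ∑ k, metricCoef g ![a, 0] h d (Sum.inr k) * solutionM a h ρ p k c b
      + ∑ k, ∑ i, 2 * Complex.I * solutionM a h ρ i k c d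
        * ∑ l, metricCoef g ![a, 0] h (Sum.inr k) (Sum.inr l) * solutionM a h ρ p l (Sum.inr i) b
      = 0 := by
  have hI := Complex.I_sq
  have I3 : Complex.I ^ 3 = -Complex.I := Complex.I_pow_three
  rcases c with γ | k <;> rcases d with α | i <;> rcases b with β | j
  all_goals
    first
    | fin_cases k
    | skip
  all_goals
    first
    | fin_cases i
    | skip
  all_goals
    first
    | fin_cases j
    | skip
  all_goals
    fin_cases p <;>
      simp [metricCoef, solutionM, Fin.sum_univ_two, gammaCoef_special hρ]
  all_goals
    field_simp
    ring_nf
    try simp only [hI, I3]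
    try ring

/-- The equations between `B`, `cl` and the remaining fields in `solutionConn`. -/
structure FieldEqs (g : Fin n → Fin n → ℂ) (a : Fin n → ℂ) (h : ℂ)
    (nA : Fin n → Fin n → ℂ) (C : Fin n → ℂ) (B : Fin 2 → Fin n → Fin n → ℂ) (cl : Fin n → ℂ) :
    Prop where
  cl_eq : ∀ α, cl α = ∑ ν, g α ν * C ν
  b_zero : ∀ α β, ∑ ν, g β ν * B 0 ν α
    = 1 / 2 * (nA β α - nA α β) + a β / h * ∑ ν, a ν * B 0 ν α
  b_one : ∀ α β, ∑ ν, g β ν * B 1 ν α = -(1 / h) * a β * cl α + a β / h * ∑ ν, a ν * B 1 ν α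

lemma fieldEqs_iff {g : Fin n → Fin n → ℂ} {a : Fin n → ℂ} {h : ℂ}
    (hdet : (gTilde g a h).det ≠ 0) {nA : Fin n → Fin n → ℂ} {C : Fin n → ℂ}
    {B : Fin 2 → Fin n → Fin n → ℂ} {cl : Fin n → ℂ} :
    FieldEqs g a h nA C B cl ↔ (cl = fun α => ∑ ν, g α ν * C ν) ∧
      B = bField (gTilde g a h) a h nA cl := by
  constructor
  · rintro ⟨h1, h2, h3⟩
    refine ⟨funext h1, ?_⟩
    have key : ∀ i α, (fun μ => B i μ α) = fun μ => bField (gTilde g a h) a h nA cl i μ α := by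
      intro i α
      rw [bField_eq_mulVec, eq_inv_mulVec_iff hdet]
      intro β
      fin_cases i
      · exact h2 α β
      · exact h3 α β
    funext i μ α
    exact congrFun (key i α) μ
  · rintro ⟨h1, h2⟩
    have key : ∀ i α β, _ := fun i α β => (eq_inv_mulVec_iff hdet _ _).1
      (bField_eq_mulVec (gTilde g a h) a h nA cl i α) β
    rw [← h2] at key
    exact ⟨congrFun h1, key 0, key 1⟩

/-- These are the contractions multiplied by the braiding correction in the scalar equations. They
vanish by the choice of `E^1_1` and `E^2_2` and by `A_μ C^μ = 0`. -/
lemma solutionN_inner (hh : h ≠ 0) {Γ : Fin n → Fin n → Fin n → ℂ} {nA : Fin n → Fin n → ℂ}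
    {C : Fin n → ℂ} {B : Fin 2 → Fin n → Fin n → ℂ} {cl : Fin n → ℂ}
    (horth : ∑ μ, a μ * C μ = 0) (i : Fin 2) (b : Idx n) :
    lower g a h (fun x => solutionN a h B cl Γ nA C x (Sum.inr i) b) (Sum.inr i) = 0 := by
  rcases b with β | j
  · fin_cases i
    · simp [lower, solutionN, hh]
    · simp [lower, solutionN]
  · fin_cases i
    · simp [lower, solutionN, ← mul_assoc, ← Finset.sum_mul, horth]
    · simp [lower, solutionN]

/-- Scalar compatibility for the uncorrected flip; with `solutionN_inner` it gives the full scalar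
equation. -/
lemma solutionN_compat (hg : ∀ μ ν, g μ ν = g ν μ) (hh : h ≠ 0)
    {Γ : Fin n → Fin n → Fin n → ℂ} {nA : Fin n → Fin n → ℂ}
    {C : Fin n → ℂ} {B : Fin 2 → Fin n → Fin n → ℂ} {cl : Fin n → ℂ}
    (hnA : ∀ α β, nA α β = da α β - ∑ μ, Γ μ α β * a μ)
    (P : PointSolution g a h dg Γ nA C) (F : FieldEqs g a h nA C B cl) (c d b : Idx n) :
    dMetric dg (fun μ => ![da μ, 0]) 0 c d b
      + lower g a h (fun x => solutionN a h B cl Γ nA C x c d) b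
      + lower g a h (fun x => solutionN a h B cl Γ nA C x c b) d = 0 := by
  obtain ⟨F1, F2, F3⟩ := F
  obtain ⟨-, P2, P3⟩ := P
  rcases c with γ | k <;> rcases d with α | i <;> rcases b with β | j
  · have e := P2 γ α β
    simp [dMetric, metricCoef, lower, solutionN]
    simp only [hg _ β] at e
    simp only [mul_comm (g _ _)]
    field_simp at e ⊢
    linear_combination e
  · fin_cases j
    · simp [dMetric, metricCoef, lower, solutionN, F2, hnA]
      simp only [mul_comm (a _)]
      field_simp
      ring
    · simp [dMetric, metricCoef, lower, solutionN, F3]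
      field_simp
      ring
  · fin_cases i
    · simp [dMetric, metricCoef, lower, solutionN, F2, hnA]
      simp only [mul_comm (a _)]
      field_simp
      ring
    · simp [dMetric, metricCoef, lower, solutionN, F3]
      field_simp
      ring
  · fin_cases i <;> fin_cases j <;> simp [dMetric, metricCoef, lower, solutionN]
    all_goals
      field_simp
      ring
  · fin_cases k
    · simp [dMetric, lower, solutionN, F2]
      field_simp
      ring
    · simp [dMetric, lower, solutionN, F3]
      field_simp
      ring
  · fin_cases k <;> fin_cases j <;> simp [dMetric, lower, solutionN, ← F1]
    all_goals
      field_simp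
      ring
  · fin_cases k <;> fin_cases i <;> simp [dMetric, lower, solutionN, ← F1]
    all_goals
      field_simp
      ring
  · fin_cases k <;> fin_cases i <;> fin_cases j <;> simp [dMetric, lower, solutionN, P3]

/-- The Pauli part is diagonal, so the correction involves only the contractions of
`solutionN_inner`. -/
lemma solutionM_off (hρ : ρ ≠ 0) {i k : Fin 2} (hik : i ≠ k) (c d : Idx n) :
    solutionM a h ρ i k c d = 0 := by
  rcases c with γ | j <;> rcases d with α | l
  all_goals
    first
    | fin_cases j
    | skip
  all_goals
    first
    | fin_cases l
    | skip
  all_goals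
    fin_cases i <;> fin_cases k <;> simp [solutionM, gammaCoef_special hρ] at hik ⊢

/-- The geometry of `solutionConn` is a quantum Levi-Civita connection. -/
theorem pointQLC_solution (hg : ∀ μ ν, g μ ν = g ν μ) (hh : h ≠ 0) (hρ : ρ ≠ 0)
    (hdet : (gTilde g a h).det ≠ 0) {Γ : Fin n → Fin n → Fin n → ℂ} {nA : Fin n → Fin n → ℂ}
    {C : Fin n → ℂ} (hnA : ∀ α β, nA α β = da α β - ∑ μ, Γ μ α β * a μ)
    (P : PointSolution g a h dg Γ nA C) :
    PointQLC (metricCoef g ![a, 0] h) (dMetric dg (fun μ => ![da μ, 0]) 0)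
      (solutionConn g a h ρ Γ nA C)
      (solutionN a h (bField (gTilde g a h) a h nA fun α => ∑ ν, g α ν * C ν)
        (fun α => ∑ ν, g α ν * C ν) Γ nA C) (solutionM a h ρ) := by
  refine ⟨solutionConn_eq_connOf g a h ρ Γ nA C, ⟨?_, ?_, ?_, ?_, ?_, ?_⟩, ?_,
    solutionM_pauli hh hρ⟩
  · rintro (l | k) μ ν
    · simp [solutionN, P.Γ_symm l μ ν]
    · simp [solutionN, add_comm]
  · rintro (l | k) μ i <;> rfl
  · rintro (l | k) <;> simp [solutionN]
  · intro p k μ ν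
    simp [solutionM, mul_comm]
  · intro p k μ i
    rfl
  · intro p k
    exact gammaCoef_torsion _ _ _ k p
  · intro c d b
    have F := (fieldEqs_iff hdet (nA := nA) (C := C)).2 ⟨rfl, rfl⟩
    have e : ∀ k i : Fin 2, 2 * Complex.I * solutionM a h ρ i k c d
        * lower g a h (fun x => solutionN a h
          (bField (gTilde g a h) a h nA fun α => ∑ ν, g α ν * C ν)
          (fun α => ∑ ν, g α ν * C ν) Γ nA C x (Sum.inr i) b) (Sum.inr k) = 0 := by
      intro k i
      by_cases hik : i = k
      · subst hik
        rw [solutionN_inner hh P.orthogonal, mul_zero]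
      · rw [solutionM_off hρ hik, mul_zero, zero_mul]
    simp only [sum_metricCoef_mul, sum_metricCoef_mul' hg, e, Finset.sum_const_zero, add_zero]
    exact solutionN_compat hg hh hnA P F c d b

/-! ### Solving the equations -/

section Solve

variable {nn : Idx n → Idx n → Idx n → ℂ} {mm : Fin 2 → Fin 2 → Idx n → Idx n → ℂ}
  {dG : Idx n → Idx n → Idx n → ℂ}

/-- The Pauli equations become linear when solved in order: the known inner entries determine the
mixed ones, and these determine the `dx ⊗ dx` entries. -/
lemma eq_solutionM (hh : h ≠ 0) (hρ : ρ ≠ 0) (T : TorsionFreeCoef nn mm)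
    (H : CompatAt (metricCoef g ![a, 0] h) dG nn mm)
    (hm : ∀ p k i j, mm p k (Sum.inr i) (Sum.inr j) = gammaCoef (1 + ρ) (1 - ρ) ρ k i j p) :
    mm = solutionM a h ρ := by
  have hI := Complex.I_sq
  have hs : ∀ p k i μ, mm p k (Sum.inr i) (Sum.inl μ)
      = if p = 0 ∧ k = 0 ∧ i = 0 then Complex.I / h * a μ else 0 := by
    intro p k i μ
    have e := fun i j => H.pauli p (Sum.inr i) (Sum.inr j) (Sum.inl μ)
    simp only [hm] at e
    have e00 := e 0 0
    have e01 := e 0 1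
    have e10 := e 1 0
    have e11 := e 1 1
    have f0 : (![0, 0] : Fin 2 → ℂ) p = 0 := by fin_cases p <;> rfl
    simp [metricCoef, gammaCoef_special hρ, f0] at e00 e01 e10 e11
    -- The inner entry `i` contributes the factor `1 + 2i·i = -1`, so the unknown keeps a nonzero
    -- coefficient; the same happens in `x00`.
    have x11 : mm p 1 (Sum.inr 1) (Sum.inl μ) = 0 := by
      apply mul_left_cancel₀ hh
      linear_combination e11 + 2 * h * mm p 1 (Sum.inr 1) (Sum.inl μ) * hI
    have x10 : mm p 1 (Sum.inr 0) (Sum.inl μ) = 0 := by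
      apply mul_left_cancel₀ hh
      linear_combination -e01 + 4 * Complex.I * ρ * h * x11
    have x01 : mm p 0 (Sum.inr 1) (Sum.inl μ) = 0 := e10.resolve_left hh
    have x00 : mm p 0 (Sum.inr 0) (Sum.inl μ) = ![Complex.I, 0] p / h * a μ := by
      field_simp
      linear_combination -e00 + 2 * h * mm p 0 (Sum.inr 0) (Sum.inl μ) * hI
    fin_cases k <;> fin_cases i
    · refine x00.trans ?_
      fin_cases p <;> simp
    · simp [x01]
    · simp [x10]
    · simp [x11]
  have hd : ∀ p k μ ν, mm p k (Sum.inl μ) (Sum.inl ν)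
      = if p = 0 ∧ k = 0 then Complex.I / h ^ 2 * (a μ * a ν) else 0 := by
    intro p k μ ν
    have e := fun i => H.pauli p (Sum.inl μ) (Sum.inr i) (Sum.inl ν)
    simp only [T.mm_ds, hs] at e
    have e0 := e 0
    have e1 := e 1
    simp [metricCoef] at e0 e1
    have x1 : mm p 1 (Sum.inl μ) (Sum.inl ν) = 0 := e1.resolve_left hh
    fin_cases k
    · fin_cases p
      · simp at e0 ⊢
        apply mul_left_cancel₀ hh
        field_simp at e0 ⊢
        linear_combination e0 - 2 * a μ * a ν * Complex.I * hI
      · simpa [hh] using e0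
    · simp [x1]
  funext p k b c
  rcases b with α | i <;> rcases c with β | j
  · exact hd p k α β
  · rw [T.mm_ds]
    exact hs p k j α
  · exact hs p k i β
  · exact hm p k i j

end Solve

section Solve

variable {nn : Idx n → Idx n → Idx n → ℂ} {mm : Fin 2 → Fin 2 → Idx n → Idx n → ℂ}
  {dG : Idx n → Idx n → Idx n → ℂ}

/-- A quantum Levi-Civita connection with the given inner part is the one of `solutionConn`. -/
theorem solution_of_pointQLC (hg : ∀ μ ν, g μ ν = g ν μ) (hh : h ≠ 0) (hρ : ρ ≠ 0)
    (hdet : (gTilde g a h).det ≠ 0) (T : TorsionFreeCoef nn mm)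
    (H : CompatAt (metricCoef g ![a, 0] h) (dMetric dg (fun μ => ![da μ, 0]) dh) nn mm)
    (hm : ∀ p k i j, mm p k (Sum.inr i) (Sum.inr j) = gammaCoef (1 + ρ) (1 - ρ) ρ k i j p)
    (hn : ∀ k i j, nn (Sum.inr k) (Sum.inr i) (Sum.inr j) = 0)
    {Γ : Fin n → Fin n → Fin n → ℂ} {nA : Fin n → Fin n → ℂ} {C : Fin n → ℂ}
    (hΓ : ∀ μ α β, Γ μ α β = -nn (Sum.inl μ) (Sum.inl α) (Sum.inl β))
    (hnA : ∀ α β, nA α β = da α β - ∑ μ, Γ μ α β * a μ)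
    (hC : ∀ μ, C μ = nn (Sum.inl μ) (Sum.inr 0) (Sum.inr 1)) :
    dh = 0 ∧ PointSolution g a h dg Γ nA C ∧
      nn = solutionN a h (bField (gTilde g a h) a h nA fun α => ∑ ν, g α ν * C ν)
        (fun α => ∑ ν, g α ν * C ν) Γ nA C := by
  have hI := Complex.I_sq
  have hM := eq_solutionM hh hρ T H hm
  subst hM
  -- With a diagonal Pauli part, only the pairs `i = k` remain in the braiding correction.
  have hsc : ∀ c d b, dMetric dg (fun μ => ![da μ, 0]) dh c d b
      + lower g a h (fun x => nn x c d) b + lower g a h (fun x => nn x c b) d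
      + 2 * Complex.I * (solutionM a h ρ 0 0 c d
          * lower g a h (fun x => nn x (Sum.inr 0) b) (Sum.inr 0)
        + solutionM a h ρ 1 1 c d
          * lower g a h (fun x => nn x (Sum.inr 1) b) (Sum.inr 1)) = 0 := by
    intro c d b
    have e := H.scalar c d b
    simp only [sum_metricCoef_mul, sum_metricCoef_mul' hg, Fin.sum_univ_two,
      solutionM_off hρ (zero_ne_one : (0 : Fin 2) ≠ 1),
      solutionM_off hρ (one_ne_zero : (1 : Fin 2) ≠ 0)] at e
    linear_combination e
  -- the inner components
  have w : ∀ i j, ∑ ν, a ν * nn (Sum.inl ν) (Sum.inr i) (Sum.inr j) = 0 := by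
    have e001 := hsc (Sum.inr 0) (Sum.inr 0) (Sum.inr 1)
    have e100 := hsc (Sum.inr 1) (Sum.inr 0) (Sum.inr 0)
    have e110 := hsc (Sum.inr 1) (Sum.inr 1) (Sum.inr 0)
    simp [lower, dMetric, hn, solutionM, gammaCoef_special hρ] at e001 e100 e110
    have e00 : ∑ ν, a ν * nn (Sum.inl ν) (Sum.inr 0) (Sum.inr 0)
        = -∑ ν, a ν * nn (Sum.inl ν) (Sum.inr 1) (Sum.inr 1) := by
      rw [← Finset.sum_neg_distrib]
      refine Finset.sum_congr rfl fun ν _ => ?_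
      linear_combination a ν * T.nn_ss (Sum.inl ν)
    have e01 : ∑ ν, a ν * nn (Sum.inl ν) (Sum.inr 0) (Sum.inr 1) = 0 := by
      linear_combination -e001 + 2 * (∑ ν, a ν * nn (Sum.inl ν) (Sum.inr 0) (Sum.inr 1)) * hI
    intro i j
    fin_cases i <;> fin_cases j
    · exact e00.trans (by rw [e110, neg_zero])
    · exact e01
    · exact e100
    · exact e110
  -- `g` itself may be degenerate; on vectors orthogonal to `a` it agrees with `g̃`, which is
  -- injective.
  have hinj : ∀ x : Fin n → ℂ, (∀ β, ∑ ν, g β ν * x ν = 0) → ∑ ν, a ν * x ν = 0 → x = 0 := by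
    intro x h1 h2
    have := (eq_inv_mulVec_iff hdet x 0).2 fun β => by rw [h1, h2]; simp
    rwa [Matrix.mulVec_zero] at this
  -- Let `X` be the contraction of `(s¹, dx^μ)` with `s¹`, and `Y` that of `(s¹, s¹)` with `dx^μ`.
  -- The triple `(s¹, dx^μ, s¹)` gives `X + Y = 0`, while `(s¹, s¹, dx^μ)` gives `Y - X = 0` through
  -- the factor `-1` of the braiding; hence both vanish. The same argument applies to `s²`.
  have hXY : ∀ μ, (∑ ν, a ν * nn (Sum.inl ν) (Sum.inr 0) (Sum.inl μ)
        + h * nn (Sum.inr 0) (Sum.inr 0) (Sum.inl μ) = 0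
      ∧ ∑ ν, g μ ν * nn (Sum.inl ν) (Sum.inr 0) (Sum.inr 0) = 0)
      ∧ -(h * nn (Sum.inr 1) (Sum.inr 1) (Sum.inl μ)) = 0 := by
    intro μ
    have e00 := hsc (Sum.inr 0) (Sum.inr 0) (Sum.inl μ)
    have e11 := hsc (Sum.inr 1) (Sum.inr 1) (Sum.inl μ)
    have f00 := hsc (Sum.inr 0) (Sum.inl μ) (Sum.inr 0)
    have f11 := hsc (Sum.inr 1) (Sum.inl μ) (Sum.inr 1)
    simp [lower, dMetric, hn, solutionM, gammaCoef_special hρ, w] at e00 e11 f00 f11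
    have x0 : ∑ ν, a ν * nn (Sum.inl ν) (Sum.inr 0) (Sum.inl μ)
        + h * nn (Sum.inr 0) (Sum.inr 0) (Sum.inl μ) = 0 := by
      linear_combination (f00 - e00) / 2
        + (∑ ν, a ν * nn (Sum.inl ν) (Sum.inr 0) (Sum.inl μ)
        + h * nn (Sum.inr 0) (Sum.inr 0) (Sum.inl μ)) * hI
    refine ⟨⟨x0, by linear_combination f00 - x0⟩, ?_⟩
    linear_combination (f11 - e11) / 2 - h * nn (Sum.inr 1) (Sum.inr 1) (Sum.inl μ) * hI
  -- All corrected contractions are zero, so scalar compatibility holds for the plain flip.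
  have hz : ∀ c d b, dMetric dg (fun μ => ![da μ, 0]) dh c d b
      + lower g a h (fun x => nn x c d) b + lower g a h (fun x => nn x c b) d = 0 := by
    intro c d b
    have hX : ∀ i b, lower g a h (fun x => nn x (Sum.inr i) b) (Sum.inr i) = 0 := by
      rintro i (μ | j) <;> fin_cases i
      · exact (hXY μ).1.1
      · simpa [lower] using (hXY μ).2
      · simp [lower, hn, w]
      · simp [lower, hn]
    have e := hsc c d b
    rw [hX, hX] at e
    simpa using e
  have n00 : ∀ μ, nn (Sum.inl μ) (Sum.inr 0) (Sum.inr 0) = 0 :=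
    congrFun (hinj (fun ν => nn (Sum.inl ν) (Sum.inr 0) (Sum.inr 0)) (fun β => (hXY β).1.2) (w 0 0))
  have n11 : ∀ μ, nn (Sum.inl μ) (Sum.inr 1) (Sum.inr 1) = 0 := fun μ => by
    simpa [n00] using T.nn_ss (Sum.inl μ)
  have z00 : ∀ μ, h * nn (Sum.inr 0) (Sum.inr 0) (Sum.inl μ)
      = -∑ ν, a ν * nn (Sum.inl ν) (Sum.inr 0) (Sum.inl μ) := fun μ => by
    linear_combination (hXY μ).1.1
  have z11 : ∀ μ, nn (Sum.inr 1) (Sum.inr 1) (Sum.inl μ) = 0 := fun μ => by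
    simpa [hh] using (hXY μ).2
  have z10 : ∀ μ, h * nn (Sum.inr 1) (Sum.inr 0) (Sum.inl μ) = ∑ ν, g μ ν * C ν := by
    intro μ
    have e := hz (Sum.inr 0) (Sum.inr 1) (Sum.inl μ)
    simp [lower, dMetric, hn, ← hC] at e
    linear_combination -e
  have z01' : ∀ μ, ∑ ν, g μ ν * nn (Sum.inl ν) (Sum.inr 1) (Sum.inr 0)
      + (∑ ν, a ν * nn (Sum.inl ν) (Sum.inr 1) (Sum.inl μ)
        + h * nn (Sum.inr 0) (Sum.inr 1) (Sum.inl μ)) = 0 := by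
    intro μ
    have e := hz (Sum.inr 1) (Sum.inr 0) (Sum.inl μ)
    simpa [lower, dMetric, hn] using e
  have z01 : ∀ μ, h * nn (Sum.inr 0) (Sum.inr 1) (Sum.inl μ)
      = ∑ ν, g μ ν * C ν - ∑ ν, a ν * nn (Sum.inl ν) (Sum.inr 1) (Sum.inl μ) := by
    intro μ
    have e := hz (Sum.inl μ) (Sum.inr 0) (Sum.inr 1)
    simp [lower, dMetric, metricCoef, T.nn_ds] at e
    linear_combination e + z10 μ
  -- Torsion freeness does not relate the `(s¹, s²)` and `(s², s¹)` entries. Antisymmetry comes from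
  -- compatibility: their sum is annihilated by both `g` and `a`.
  have n10 : ∀ μ, nn (Sum.inl μ) (Sum.inr 1) (Sum.inr 0) = -C μ := by
    have e := hinj (fun ν => nn (Sum.inl ν) (Sum.inr 1) (Sum.inr 0) + C ν) ?_ ?_
    · intro μ
      exact eq_neg_of_add_eq_zero_left (congrFun e μ)
    · intro β
      simp only [mul_add, Finset.sum_add_distrib]
      linear_combination z01' β - z01 β
    · simp only [mul_add, Finset.sum_add_distrib, hC, w, add_zero]
  have s00 : ∀ α β, _ := fun α β => hz (Sum.inr 0) (Sum.inl α) (Sum.inl β)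
  have s01 : ∀ α β, _ := fun α β => hz (Sum.inr 1) (Sum.inl α) (Sum.inl β)
  have t00 : ∀ α β, _ := fun α β => hz (Sum.inl α) (Sum.inl β) (Sum.inr 0)
  have t01 : ∀ α β, _ := fun α β => hz (Sum.inl α) (Sum.inl β) (Sum.inr 1)
  simp [lower, dMetric, metricCoef, T.nn_ds] at s00 s01 t00 t01
  have nA' : ∀ α β, nA α β = da α β + ∑ ν, a ν * nn (Sum.inl ν) (Sum.inl α) (Sum.inl β) := by
    intro α β
    rw [hnA, sub_eq_add_neg, ← Finset.sum_neg_distrib]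
    congr 1
    refine Finset.sum_congr rfl fun ν _ => ?_
    rw [hΓ]
    ring
  -- A Koszul-type combination: symmetrising the `dx`-equations and subtracting the `s`-equation
  -- removes the `B`-terms.
  have d0 : ∀ α β, h * nn (Sum.inr 0) (Sum.inl α) (Sum.inl β) = -(1 / 2 * (nA α β + nA β α)) := by
    intro α β
    rw [nA', nA']
    linear_combination (t00 α β + t00 β α - s00 α β) / 2 + h / 2 * T.nn_dd (Sum.inr 0) α β
  have d1 : ∀ α β, nn (Sum.inr 1) (Sum.inl α) (Sum.inl β) = 0 := by
    intro α β
    apply mul_left_cancel₀ hh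
    linear_combination (s01 α β - t01 α β - t01 β α) / 2 + h / 2 * T.nn_dd (Sum.inr 1) α β
  have F : FieldEqs g a h nA C (fun i μ α => nn (Sum.inl μ) (Sum.inr i) (Sum.inl α))
      (fun α => ∑ ν, g α ν * C ν) := by
    refine ⟨fun α => rfl, fun α β => ?_, fun α β => ?_⟩
    · have e : nn (Sum.inr 0) (Sum.inr 0) (Sum.inl α)
          = -(∑ ν, a ν * nn (Sum.inl ν) (Sum.inr 0) (Sum.inl α)) / h := by
        field_simp
        linear_combination z00 α
      have e' := t00 α β
      rw [e] at e'
      linear_combination e' + nA' α β - d0 α β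
    · have e : nn (Sum.inr 0) (Sum.inr 1) (Sum.inl α)
          = (∑ ν, g α ν * C ν - ∑ ν, a ν * nn (Sum.inl ν) (Sum.inr 1) (Sum.inl α)) / h := by
        field_simp
        linear_combination z01 α
      have e' := t01 α β
      rw [e, d1] at e'
      linear_combination e'
  have hB := ((fieldEqs_iff hdet).1 F).2
  refine ⟨?_, ⟨?_, ?_, ?_⟩, ?_⟩
  -- The equation `(dx^μ, s¹, s¹)` is `∂_μ h + 2X = 0`, and `X` vanishes by `hXY`.
  · funext μ
    have e := hz (Sum.inl μ) (Sum.inr 0) (Sum.inr 0)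
    simp [lower, dMetric, metricCoef, T.nn_ds] at e
    rw [Pi.zero_apply]
    linear_combination e - 2 * (hXY μ).1.1
  · intro μ α β
    rw [hΓ, hΓ, T.nn_dd]
  · intro γ α β
    have e := hz (Sum.inl γ) (Sum.inl α) (Sum.inl β)
    simp [lower, dMetric, metricCoef] at e
    have e1 : ∀ x y z, ∑ ν, g x ν * nn (Sum.inl ν) y z = -∑ ν, g x ν * -nn (Sum.inl ν) y z := by
      intro x y z
      simp
    have f : ∀ α β, nn (Sum.inr 0) (Sum.inl α) (Sum.inl β) = -(1 / 2 * (nA α β + nA β α)) / h := by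
      intro α β
      field_simp
      linear_combination 2 * d0 α β
    rw [e1, e1, f, f] at e
    simp only [← hΓ, mul_comm (g _ _)] at e
    simp only [hg _ β]
    linear_combination e
  · simpa [hC] using w 0 1
  · have q : ∀ k i α, nn (Sum.inr k) (Sum.inr i) (Sum.inl α)
        = ![![-(1 / h * ∑ μ, a μ * nn (Sum.inl μ) (Sum.inr 0) (Sum.inl α)),
            1 / h * (∑ ν, g α ν * C ν - ∑ μ, a μ * nn (Sum.inl μ) (Sum.inr 1) (Sum.inl α))],
          ![1 / h * ∑ ν, g α ν * C ν, 0]] k i := by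
      intro k i α
      fin_cases k <;> fin_cases i <;> simp
      · field_simp
        linear_combination z00 α
      · field_simp
        linear_combination z01 α
      · field_simp
        linear_combination z10 α
      · exact z11 α
    rw [← hB]
    funext x b c
    rcases x with μ | k <;> rcases b with α | i <;> rcases c with β | j
    · simp [solutionN, hΓ]
    · simp [solutionN, T.nn_ds]
    · simp [solutionN]
    · fin_cases i <;> fin_cases j <;> simp [solutionN, n00, n11, n10, hC]
    · fin_cases k
      · simp [solutionN]
        apply mul_left_cancel₀ hh
        rw [d0]
        field_simp
      · simp [solutionN, d1]
    · rw [T.nn_ds]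
      exact q k j α
    · exact q k i β
    · exact hn k i j

end Solve

/-! ### Reality -/

/-- The conjugate of `B` solves the same linear system with real data, whose solution is unique. -/
lemma bField_star {g : Fin n → Fin n → ℂ} {a : Fin n → ℂ} {h : ℂ}
    (hdet : (gTilde g a h).det ≠ 0) {nA : Fin n → Fin n → ℂ} {cl : Fin n → ℂ}
    (hg : ∀ μ ν, star (g μ ν) = g μ ν) (ha : ∀ μ, star (a μ) = a μ) (hh : star h = h)
    (hnA : ∀ α β, star (nA α β) = nA α β) (hcl : ∀ α, star (cl α) = cl α)
    (i : Fin 2) (μ α : Fin n) :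
    star (bField (gTilde g a h) a h nA cl i μ α) = bField (gTilde g a h) a h nA cl i μ α := by
  have key : (fun μ => star (bField (gTilde g a h) a h nA cl i μ α))
      = fun μ => bField (gTilde g a h) a h nA cl i μ α := by
    rw [bField_eq_mulVec, eq_inv_mulVec_iff hdet]
    intro β
    have e := congrArg star ((eq_inv_mulVec_iff hdet _ _).1
      (bField_eq_mulVec (gTilde g a h) a h nA cl i α) β)
    simp only [star_add, star_mul', star_sum, star_div₀, hg, ha, hh] at e
    rw [e]
    congr 1
    fin_cases i <;> simp at hnA hcl ha hh ⊢ <;> simp [hnA, hcl, ha, hh]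
  exact congrFun key μ

/-- In the scalar condition the braiding correction vanishes: the Pauli part is diagonal, whereas
the inner block of the scalar part has zero diagonal. So it only asks for real coefficients; the
Pauli condition is a finite check using `star ρ = -ρ`. -/
theorem starAt_solution {g : Fin n → Fin n → ℂ} {a : Fin n → ℂ} {h ρ : ℂ}
    (hρ0 : ρ ≠ 0) (hdet : (gTilde g a h).det ≠ 0) {Γ : Fin n → Fin n → Fin n → ℂ}
    {nA : Fin n → Fin n → ℂ} {C : Fin n → ℂ}
    (hg : ∀ μ ν, star (g μ ν) = g μ ν) (ha : ∀ μ, star (a μ) = a μ) (hh : star h = h)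
    (hρ : star ρ = -ρ) (hΓ : ∀ μ α β, star (Γ μ α β) = Γ μ α β)
    (hnA : ∀ α β, star (nA α β) = nA α β) (hC : ∀ μ, star (C μ) = C μ) :
    StarAt (solutionN a h (bField (gTilde g a h) a h nA fun α => ∑ ν, g α ν * C ν)
        (fun α => ∑ ν, g α ν * C ν) Γ nA C) (solutionM a h ρ) := by
  have hI := Complex.I_sq
  have hcl : ∀ α, star (∑ ν, g α ν * C ν) = ∑ ν, g α ν * C ν := by
    intro α
    simp only [star_sum, star_mul', hg, hC]
  have hB := bField_star hdet hg ha hh hnA hcl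
  have I3 : Complex.I ^ 3 = -Complex.I := Complex.I_pow_three
  have hh' : (starRingEnd ℂ) h = h := hh
  have ha' : ∀ μ, (starRingEnd ℂ) (a μ) = a μ := ha
  have hρ' : (starRingEnd ℂ) ρ = -ρ := hρ
  have hnA' : ∀ α β, (starRingEnd ℂ) (nA α β) = nA α β := hnA
  set cl : Fin n → ℂ := fun α => ∑ ν, g α ν * C ν
  set B := bField (gTilde g a h) a h nA cl
  have hsum : ∀ i α, star (∑ μ, a μ * B i μ α) = ∑ μ, a μ * B i μ α := by
    intro i α
    simp only [star_sum, star_mul', ha, hB]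
  have hcl' : ∀ α, (starRingEnd ℂ) (cl α) = cl α := hcl
  have hE : ∀ k i α, star (solutionN a h B cl Γ nA C (Sum.inr k) (Sum.inr i) (Sum.inl α))
      = solutionN a h B cl Γ nA C (Sum.inr k) (Sum.inr i) (Sum.inl α) := by
    intro k i α
    have h0 : (starRingEnd ℂ) (∑ μ, a μ * B 0 μ α) = ∑ μ, a μ * B 0 μ α := hsum 0 α
    have h1 : (starRingEnd ℂ) (∑ μ, a μ * B 1 μ α) = ∑ μ, a μ * B 1 μ α := hsum 1 α
    simp only [solutionN]
    generalize (∑ μ, a μ * B 0 μ α) = x at *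
    generalize (∑ μ, a μ * B 1 μ α) = y at *
    fin_cases k <;> fin_cases i <;> simp [hh', hcl', h0, h1]
  refine ⟨?_, ?_⟩
  · intro x b c
    have e : ∀ k i : Fin 2, 2 * Complex.I * solutionM a h ρ i k b c
        * star (solutionN a h B cl Γ nA C x (Sum.inr i) (Sum.inr k)) = 0 := by
      intro k i
      by_cases hik : i = k
      · subst hik
        rcases x with μ | l
        · fin_cases i <;> simp [solutionN]
        · simp [solutionN]
      · rw [solutionM_off hρ0 hik, mul_zero, zero_mul]
    simp only [e, Finset.sum_const_zero, add_zero]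
    symm
    rcases x with μ | k <;> rcases b with α | i <;> rcases c with β | j
    · simpa [solutionN] using hΓ μ α β
    · exact hB j μ α
    · exact hB i μ β
    · have hC' : (starRingEnd ℂ) (C μ) = C μ := hC μ
      fin_cases i <;> fin_cases j <;> simp [solutionN, hC']
    · fin_cases k
      · simp [solutionN, hh', hnA']
      · simp [solutionN]
    · exact hE k j α
    · exact hE k i β
    · simp [solutionN]
  · intro p l b c
    rcases b with α | i <;> rcases c with β | j
    all_goals
      first
      | fin_cases i
      | skip
    all_goals
      first
      | fin_cases j
      | skip
    all_goals
      fin_cases p <;> fin_cases l <;>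
        simp [solutionM, gammaCoef_special hρ0]
    all_goals
      try simp only [hh', ha', hρ', mul_neg]
      ring_nf
      try simp only [hI, I3]
      try ring

/-- For `ρ`, the entry `-2ρ` at `(s¹, s²)` is corrected by `2i(-2ρ)·star i = -4ρ`, so that `-2ρ = -2
star ρ - 4ρ`. -/
lemma real_of_starAt {a : Fin n → ℂ} {h ρ : ℂ} (hρ0 : ρ ≠ 0) {B : Fin 2 → Fin n → Fin n → ℂ}
    {cl : Fin n → ℂ} {Γ : Fin n → Fin n → Fin n → ℂ} {nA : Fin n → Fin n → ℂ} {C : Fin n → ℂ}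
    (H : StarAt (solutionN a h B cl Γ nA C) (solutionM a h ρ)) :
    (∀ μ α β, star (Γ μ α β) = Γ μ α β) ∧ (∀ μ, star (C μ) = C μ) ∧ star ρ = -ρ := by
  have hI := Complex.I_sq
  refine ⟨fun μ α β => ?_, fun μ => ?_, ?_⟩
  · have e := H.scalar (Sum.inl μ) (Sum.inl α) (Sum.inl β)
    simp [solutionN, solutionM] at e
    exact e.symm
  · have e := H.scalar (Sum.inl μ) (Sum.inr 0) (Sum.inr 1)
    simp [solutionN, solutionM, gammaCoef_special hρ0] at e
    exact e.symm
  · have e := H.pauli 1 1 (Sum.inr 0) (Sum.inr 1)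
    simp [solutionM, gammaCoef_special hρ0] at e
    change (starRingEnd ℂ) ρ = -ρ
    linear_combination e / 2 + 2 * ρ * hI

end

end Solution

/-! ### The finite geometry -/

section Finite

lemma sigma_mul_self (i : Fin 2) : sigma i * sigma i = 1 := by
  ext k l
  fin_cases i <;> fin_cases k <;> fin_cases l <;> simp [sigma]

lemma sigma_one_mul_zero : sigma 1 * sigma 0 = -(sigma 0 * sigma 1) := by
  ext k l
  fin_cases k <;> fin_cases l <;> simp [sigma]

/-- Since `σ^i` squares to `1`, both terms are multiples `∓½` of `f - σ^i f σ^i`. -/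
lemma matD_matD (i : Fin 2) (f : Mat) : matD i (matD i f) + matD i f * Complex.I • sigma i = 0 := by
  have hI := Complex.I_sq
  have h1 : sigma i * (sigma i * f) = f := by rw [← mul_assoc, sigma_mul_self, one_mul]
  simp only [matD, mul_smul_comm, smul_mul_assoc, mul_sub, sub_mul, mul_assoc,
    h1, sigma_mul_self, mul_one]
  match_scalars
  all_goals
    ring_nf
    try simp only [hI]
    try ring

/-- The entry `-2ρ` sits at `s¹ ⊗ s²`, which the diagonal metric kills; the two remaining blocks
vanish by `matD_matD`. -/
lemma finLaplacian_special {ρ : ℂ} (hρ : ρ ≠ 0) (h : ℂ) (f : Mat) :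
    finLaplacian h (gamma (1 + ρ) (1 - ρ) ρ) f = 0 := by
  have h0 := matD_matD 0 f
  have h1 := matD_matD 1 f
  simp [finLaplacian, finMetric, gamma, gammaCoef_special hρ, Fin.sum_univ_two]
  simp only [mul_smul_comm] at h0 h1
  linear_combination (norm := module) h⁻¹ • h0 - h⁻¹ • h1

/-- The terms linear in `ρ` cancel by anticommutation of `σ¹` and `σ²`. The curvature is then the
single entry `-i(2ρ)²` at `k = l = 2`; the lift factor `1/(2i)` and the inverse metric `-1/h` turn
it into `2ρ²/h`. -/
lemma finScalar_special {ρ h : ℂ} (hρ : ρ ≠ 0) (hh : h ≠ 0) :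
    finScalar h (gamma (1 + ρ) (1 - ρ) ρ) = (2 * ρ ^ 2 / h) • (1 : Mat) := by
  simp [finScalar, finRicci, finMetric, finCurv, finD, finWedge, gamma, gammaCoef_special hρ,
    Fin.sum_univ_two, matD]
  have hI := Complex.I_sq
  have I3 : Complex.I ^ 3 = -Complex.I := Complex.I_pow_three
  rw [sigma_mul_self, sigma_mul_self, sigma_one_mul_zero]
  match_scalars
  all_goals
    field_simp
    ring_nf
    try simp only [hI, I3]
    try ring

end Finite

/-! ### Geometries in charts -/

section Charts

variable {n : ℕ} {M : Type*} [TopologicalSpace M] [ChartedSpace (E n) M]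

open Topology Filter

lemma pd_congr {f g : E n → ℂ} {y : E n} (h : f =ᶠ[𝓝 y] g) (μ : Fin n) : pd μ f y = pd μ g y := by
  rw [pd, pd, h.fderiv_eq]

lemma pd_eq_zero_of_eqOn {U : Set (E n)} (hU : IsOpen U) {f : E n → ℂ} {c : ℂ}
    (h : ∀ z ∈ U, f z = c) {y : E n} (hy : y ∈ U) (μ : Fin n) : pd μ f y = 0 := by
  rw [pd_congr (g := fun _ => c) (Filter.eventually_of_mem (hU.mem_nhds hy) h), pd_const]

lemma star_pd_of_real {U : Set (E n)} (hU : IsOpen U) {f : E n → ℂ}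
    (h : ∀ z ∈ U, star (f z) = f z) {y : E n} (hy : y ∈ U) (μ : Fin n) :
    star (pd μ f y) = pd μ f y := by
  rw [← pd_conj]
  exact pd_congr (Filter.eventually_of_mem (hU.mem_nhds hy) h) μ

lemma fderiv_eq_zero_of_pd {f : E n → ℂ} {y : E n} (h : ∀ μ, pd μ f y = 0) : fderiv ℝ f y = 0 := by
  ext v
  have hv : v = ∑ μ, v μ • EuclideanSpace.single μ (1 : ℝ) := by
    ext i
    simp [Finset.sum_apply, Pi.single_apply]
  rw [hv, map_sum]
  refine Finset.sum_eq_zero fun μ _ => ?_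
  rw [map_smul]
  have := h μ
  rw [pd] at this
  rw [this, smul_zero]

lemma contDiffOn_chart {f : M → ℂ}
    (hf : ContMDiff (modelWithCornersSelf ℝ (E n)) (modelWithCornersSelf ℝ ℂ) ∞ f)
    {e : OpenPartialHomeomorph M (E n)} (he : e ∈ charts n M) :
    ContDiffOn ℝ ∞ (fun z => f (e.symm z)) e.target :=
  contMDiffOn_iff_contDiffOn.1 (hf.comp_contMDiffOn (contMDiffOn_symm_of_mem_maximalAtlas he))

lemma differentiableAt_chart {f : M → ℂ}
    (hf : ContMDiff (modelWithCornersSelf ℝ (E n)) (modelWithCornersSelf ℝ ℂ) ∞ f)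
    {e : OpenPartialHomeomorph M (E n)} (he : e ∈ charts n M) {y : E n} (hy : y ∈ e.target) :
    DifferentiableAt ℝ (fun z => f (e.symm z)) y :=
  ((contDiffOn_chart hf he).differentiableOn (by simp)).differentiableAt
    (e.open_target.mem_nhds hy)

/-- In a chart, vanishing partial derivatives make the level sets open, without any connectedness of
the chart domain. -/
lemma isLocallyConstant_iff_pd [IsManifold (modelWithCornersSelf ℝ (E n)) ∞ M] {f : M → ℂ}
    (hf : ContMDiff (modelWithCornersSelf ℝ (E n)) (modelWithCornersSelf ℝ ℂ) ∞ f) :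
    IsLocallyConstant f ↔
      ∀ e ∈ charts n M, ∀ y ∈ e.target, ∀ μ, pd μ (fun z => f (e.symm z)) y = 0 := by
  constructor
  · intro H e he y hy μ
    have h1 : ∀ᶠ z in 𝓝 y, f (e.symm z) = f (e.symm y) :=
      (e.continuousAt_symm hy).eventually (H.eventually_eq (e.symm y))
    rw [pd_congr h1, pd_const]
  · intro H
    rw [IsLocallyConstant.iff_eventually_eq]
    intro x
    set e := chartAt (E n) x
    have he : e ∈ charts n M := IsManifold.chart_mem_maximalAtlas x
    have hx : x ∈ e.source := mem_chart_source (E n) x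
    have hopen := e.open_target.isOpen_inter_preimage_of_fderiv_eq_zero (𝕜 := ℝ)
      (fun y hy => (differentiableAt_chart hf he hy).differentiableWithinAt)
      (fun y hy => fderiv_eq_zero_of_pd (H e he y hy)) {f x}
    have hmem : e x ∈ e.target ∩ (fun z => f (e.symm z)) ⁻¹' {f x} :=
      ⟨e.map_source hx, by simp [e.left_inv hx]⟩
    have h1 := (e.continuousAt hx).eventually (hopen.mem_nhds hmem)
    filter_upwards [h1, e.open_source.mem_nhds hx] with z hz hz'
    simpa [e.left_inv hz'] using hz.2

/-! ### The quantum metric -/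

lemma metricCoef_symm {g : Fin n → Fin n → ℂ} (hg : ∀ μ ν, g μ ν = g ν μ) (A : Fin 2 → Fin n → ℂ)
    (h : ℂ) (a b : Idx n) : metricCoef g A h a b = metricCoef g A h b a := by
  rcases a with μ | i <;> rcases b with ν | j
  · exact hg _ _
  · rfl
  · rfl
  · fin_cases i <;> fin_cases j <;> simp [metricCoef]

/-- Block elimination on a kernel vector: the `s²` row kills its `s²` component, the `s¹` row
expresses the `s¹` component, and the remaining rows become `g̃`. -/
lemma det_metricCoef_ne_zero {g : Fin n → Fin n → ℂ} {a : Fin n → ℂ} {h : ℂ} (hh : h ≠ 0)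
    (hdet : (gTilde g a h).det ≠ 0) : (Matrix.of (metricCoef g ![a, 0] h)).det ≠ 0 := by
  intro H
  obtain ⟨w, hw, h0⟩ := Matrix.exists_mulVec_eq_zero_iff.2 H
  have h1 : ∀ b, lower g a h w b = 0 := fun b => by
    rw [← sum_metricCoef_mul]
    exact congrFun h0 b
  have e1 : w (Sum.inr 1) = 0 := by simpa [lower, hh] using h1 (Sum.inr 1)
  have e0 : ∑ ν, a ν * w (Sum.inl ν) + h * w (Sum.inr 0) = 0 := h1 (Sum.inr 0)
  have e0' : w (Sum.inr 0) = -(∑ ν, a ν * w (Sum.inl ν)) / h := by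
    field_simp
    linear_combination e0
  have e2 : (fun ν => w (Sum.inl ν)) = 0 := by
    have := (eq_inv_mulVec_iff hdet (fun ν => w (Sum.inl ν)) 0).2 fun β => by
      have := h1 (Sum.inl β)
      simp only [lower, e0'] at this
      simp only [Pi.zero_apply]
      linear_combination this
    rwa [Matrix.mulVec_zero] at this
  apply hw
  funext b
  rcases b with ν | i
  · exact congrFun e2 ν
  · fin_cases i
    · have e3 : ∀ ν, w (Sum.inl ν) = 0 := congrFun e2
      simpa [e3] using e0'
    · exact e1

lemma isQuantumMetric_of_det {U : Set (E n)} {g : E n → Fin n → Fin n → ℂ}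
    {A : E n → Fin 2 → Fin n → ℂ} {h : E n → ℂ} (hg : ∀ y ∈ U, ∀ μ ν, g y μ ν = g y ν μ)
    (hdet : ∀ y ∈ U, (Matrix.of (metricCoef (g y) (A y) (h y))).det ≠ 0) :
    IsQuantumMetric U fun y a b => metricCoef (g y) (A y) (h y) a b • 1 := by
  refine ⟨fun y hy => ?_,
    fun y a b => (Matrix.of (metricCoef (g y) (A y) (h y)))⁻¹ a b • 1, fun y hy => ⟨?_, ?_, ?_⟩⟩
  · ext : 1
    · funext μ ν
      simp [wedge, metricCoef, hg y hy μ ν]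
    · funext μ i
      simp [wedge, metricCoef]
    · simp [wedge, metricCoef]
  · intro a b m
    simp
  · intro c b
    have e := congrFun (congrFun (Matrix.nonsing_inv_mul _ (isUnit_iff_ne_zero.2 (hdet y hy))) c) b
    rw [Matrix.mul_apply, Matrix.one_apply] at e
    simp only [smul_mul_smul_comm, mul_one, ← Finset.sum_smul]
    have e' : ∑ a, metricCoef (g y) (A y) (h y) a b
        * (Matrix.of (metricCoef (g y) (A y) (h y)))⁻¹ c a = if c = b then 1 else 0 := by
      rw [← e]
      exact Finset.sum_congr rfl fun a _ => mul_comm _ _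
    rw [e']
    split_ifs <;> simp
  · intro a c
    have e := congrFun (congrFun (Matrix.mul_nonsing_inv _ (isUnit_iff_ne_zero.2 (hdet y hy))) a) c
    rw [Matrix.mul_apply, Matrix.one_apply] at e
    simp only [smul_mul_smul_comm, mul_one, ← Finset.sum_smul]
    have e' : ∑ b, metricCoef (g y) (A y) (h y) a b
        * (Matrix.of (metricCoef (g y) (A y) (h y)))⁻¹ b c = if a = c then 1 else 0 := e
    rw [e']
    split_ifs <;> simp

/-! ### Reduction to points -/

namespace Geometry

variable (X : Geometry n M)

/-- `𝔤` at a point. -/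
def G (e : OpenPartialHomeomorph M (E n)) (y : E n) : Idx n → Idx n → ℂ :=
  metricCoef (X.g e y) (X.A e y) (X.h (e.symm y))

/-- The derivatives of `𝔤` at a point. -/
def dG (e : OpenPartialHomeomorph M (E n)) (y : E n) : Idx n → Idx n → Idx n → ℂ :=
  dMetric (fun μ α β => pd μ (fun z => X.g e z α β) y) (fun μ i α => pd μ (fun z => X.A e z i α) y)
    (fun μ => pd μ (fun z => X.h (e.symm z)) y)

variable {X} {e : OpenPartialHomeomorph M (E n)}

lemma scalarD_G (he : e ∈ charts n M) {y : E n} (hy : y ∈ e.target) :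
    (fun c d b => scalarD (fun z => X.G e z d b) y c) = X.dG e y := by
  funext c d b
  exact scalarD_metricCoef _ _ _ _ (differentiableAt_chart X.h_smooth he hy) c d b

lemma exists_isQLC_iff (he : e ∈ charts n M) :
    (∃ S, FlipAssumption e.target S ∧ QKK.IsQLC e.target (X.metric e) (X.conn e) S) ↔
      ∀ y ∈ e.target, ∃ nn mm, PointQLC (X.G e y) (X.dG e y) (X.conn e y) nn mm := by
  refine (QKK.exists_isQLC_iff e.open_target (G := X.G e) (N := X.conn e)).trans ?_
  refine forall₂_congr fun y hy => ?_
  rw [scalarD_G he hy]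

lemma exists_isStarQLC_iff (he : e ∈ charts n M) :
    (∃ S, FlipAssumption e.target S ∧ QKK.IsQLC e.target (X.metric e) (X.conn e) S ∧
      StarPreserving e.target (X.conn e) S) ↔
      ∀ y ∈ e.target, ∃ nn mm,
        PointQLC (X.G e y) (X.dG e y) (X.conn e y) nn mm ∧ StarAt nn mm := by
  refine (QKK.exists_isStarQLC_iff e.open_target (G := X.G e) (N := X.conn e)).trans ?_
  refine forall₂_congr fun y hy => ?_
  rw [scalarD_G he hy]

lemma HasInner.coef {u v ρ : M → ℂ} (hγ : X.HasInner u v ρ) (he : e ∈ charts n M) {y : E n}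
    (hy : y ∈ e.target) {nn : Idx n → Idx n → Idx n → ℂ} {mm : Fin 2 → Fin 2 → Idx n → Idx n → ℂ}
    (hN : X.conn e y = connOf nn mm) (k i j : Fin 2) :
    nn (Sum.inr k) (Sum.inr i) (Sum.inr j) = 0 ∧ ∀ p, mm p k (Sum.inr i) (Sum.inr j)
      = gammaCoef (u (e.symm y)) (v (e.symm y)) (ρ (e.symm y)) k i j p := by
  have h1 := hγ e he y hy k i j
  rw [hN, gamma_eq_connOf] at h1
  exact pauli_ext_iff.1 h1

lemma IsStarQLC.isQLC (H : X.IsStarQLC) : X.IsQLC := by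
  intro e he
  obtain ⟨h1, -, S, h2, h3, -⟩ := H e he
  exact ⟨h1, S, h2, h3⟩

end Geometry

end Charts

/-! ### From points to the manifold. -/

namespace Geometry

variable {n : ℕ} {M : Type*} [TopologicalSpace M] [ChartedSpace (E n) M]
  {X : Geometry n M} {e : OpenPartialHomeomorph M (E n)}

/-- The Christoffel symbols `Γ^μ_{αβ}` read off from `∇ dx^μ`. -/
def christoffel (X : Geometry n M) (e : OpenPartialHomeomorph M (E n)) (y : E n)
    (μ α β : Fin n) : ℂ :=
  -(X.conn e y (Sum.inl μ) (Sum.inl α) (Sum.inl β) 0 0)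

/-- The coefficient `C^μ` of `s¹ ⊗ s²` in `∇ dx^μ`. -/
def cField (X : Geometry n M) (e : OpenPartialHomeomorph M (E n)) (y : E n) (μ : Fin n) : ℂ :=
  X.conn e y (Sum.inl μ) (Sum.inr 0) (Sum.inr 1) 0 0

theorem IsQLC.two_cases {u v ρ : M → ℂ} (H : X.IsQLC) (hρ0 : ∀ x, ρ x ≠ 0)
    (hγ : X.HasInner u v ρ) (he : e ∈ charts n M) {x : M} (hx : x ∈ e.source) :
    (∀ i μ, X.A e (e x) i μ = 0) ∨
      ((∀ μ, (v x + ρ x - 1) * X.A e (e x) 0 μ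
          = Complex.I * (v x - ρ x - 1) * X.A e (e x) 1 μ) ∧
        (u x - 1) * (v x - 1) = -(ρ x) ^ 2) := by
  have hy := e.map_source hx
  obtain ⟨nn, mm, h1, h2, h3⟩ := (exists_isQLC_iff he).1 (H e he).2 (e x) hy
  have hm := fun p k i j => (hγ.coef he hy h1 k i j).2 p
  rw [e.left_inv hx] at hm
  exact QKK.two_cases (hρ0 x) h3 h2 hm

theorem isQLC_of_directSum [IsManifold (modelWithCornersSelf ℝ (E n)) ∞ M] {u v ρ : M → ℂ}
    (hh : ∀ x, X.h x ≠ 0) (hρ0 : ∀ x, ρ x ≠ 0) (hloc : IsLocallyConstant X.h)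
    (hA : ∀ e ∈ charts n M, ∀ y ∈ e.target,
      (∀ i μ, X.A e y i μ = 0) ∧ (Matrix.of (X.g e y)).det ≠ 0)
    (hΓ : ∀ e ∈ charts n M, ∃ Γ : E n → Fin n → Fin n → Fin n → ℂ,
      ∀ y ∈ e.target, (∀ μ α β, Γ y μ α β = Γ y μ β α) ∧
        (∀ α β ν, covG Γ (X.g e) y α β ν = 0) ∧
        X.conn e y = directSumConn (Γ y)
          (gamma (u (e.symm y)) (v (e.symm y)) (ρ (e.symm y)))) : X.IsQLC := by
  intro e he
  have hA0 : ∀ y ∈ e.target, X.A e y = 0 := fun y hy => by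
    funext i μ
    exact (hA e he y hy).1 i μ
  refine ⟨isQuantumMetric_of_det (g := X.g e) (A := X.A e) (h := fun y => X.h (e.symm y))
    (X.g_symm e he) fun y hy => ?_, (exists_isQLC_iff he).2 fun y hy => ?_⟩
  · have e1 : X.A e y = ![0, 0] := by
      rw [hA0 y hy]
      funext i
      fin_cases i <;> rfl
    rw [e1]
    refine det_metricCoef_ne_zero (hh _) ?_
    have e2 : gTilde (X.g e y) 0 (X.h (e.symm y)) = Matrix.of (X.g e y) := by
      ext μ ν
      simp [gTilde]
    rw [e2]
    exact (hA e he y hy).2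
  · obtain ⟨Γ, hΓ⟩ := hΓ e he
    obtain ⟨h1, h2, h3⟩ := hΓ y hy
    have e1 : X.dG e y = dMetric (fun μ α β => pd μ (fun z => X.g e z α β) y) 0 0 := by
      rw [dG]
      congr 1
      · funext μ i α
        exact pd_eq_zero_of_eqOn e.open_target (fun z hz => (hA e he z hz).1 i α) hy μ
      · funext μ
        exact (isLocallyConstant_iff_pd X.h_smooth).1 hloc e he y hy μ
    rw [e1, h3, G, hA0 y hy]
    exact ⟨_, _, pointQLC_directSum (hρ0 _) h1 h2⟩

/-! ### The case `u = 1 + ρ`, `v = 1 - ρ`, `A_2 = 0` -/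

lemma A_eq {y : E n} (hA : ∀ μ, X.A e y 1 μ = 0) : X.A e y = ![X.A e y 0, 0] := by
  funext i
  fin_cases i
  · rfl
  · funext μ
    exact hA μ

lemma G_eq {y : E n} (hA : ∀ μ, X.A e y 1 μ = 0) :
    X.G e y = metricCoef (X.g e y) ![X.A e y 0, 0] (X.h (e.symm y)) := by
  rw [G, A_eq hA]
  rfl

lemma dG_eq (hA : ∀ y ∈ e.target, ∀ μ, X.A e y 1 μ = 0) {y : E n} (hy : y ∈ e.target) :
    X.dG e y = dMetric (fun μ α β => pd μ (fun z => X.g e z α β) y)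
      (fun μ => ![fun α => pd μ (fun z => X.A e z 0 α) y, 0])
      (fun μ => pd μ (fun z => X.h (e.symm z)) y) := by
  rw [dG]
  congr 1
  funext μ i
  fin_cases i
  · rfl
  · funext α
    exact pd_eq_zero_of_eqOn e.open_target (fun z hz => hA z hz α) hy μ

lemma isQuantumMetric_special (hh : ∀ x, X.h x ≠ 0) (he : e ∈ charts n M)
    (hA : ∀ y ∈ e.target, (∀ μ, X.A e y 1 μ = 0) ∧
      (gTilde (X.g e y) (X.A e y 0) (X.h (e.symm y))).det ≠ 0) :
    IsQuantumMetric e.target (X.metric e) := by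
  refine isQuantumMetric_of_det (g := X.g e) (A := X.A e) (h := fun y => X.h (e.symm y))
    (X.g_symm e he) fun y hy => ?_
  rw [A_eq (hA y hy).1]
  exact det_metricCoef_ne_zero (hh _) (hA y hy).2

/-- The tensorial equations of `IsSolution` at a point of a chart. -/
abbrev PointSolutionAt (X : Geometry n M) (e : OpenPartialHomeomorph M (E n)) (y : E n)
    (Γ : E n → Fin n → Fin n → Fin n → ℂ) (C : E n → Fin n → ℂ) : Prop :=
  PointSolution (X.g e y) (X.A e y 0) (X.h (e.symm y)) (fun μ α β => pd μ (fun z => X.g e z α β) y)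
    (Γ y) (covA Γ (fun z => X.A e z 0) y) (C y)

/-- The scalar coefficients of `solutionConn` at a point of a chart. -/
abbrev solutionNAt (X : Geometry n M) (e : OpenPartialHomeomorph M (E n)) (y : E n)
    (Γ : E n → Fin n → Fin n → Fin n → ℂ) (C : E n → Fin n → ℂ) : Idx n → Idx n → Idx n → ℂ :=
  solutionN (X.A e y 0) (X.h (e.symm y))
    (bField (gTilde (X.g e y) (X.A e y 0) (X.h (e.symm y))) (X.A e y 0) (X.h (e.symm y))
      (covA Γ (fun z => X.A e z 0) y) fun α => ∑ ν, X.g e y α ν * C y ν)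
    (fun α => ∑ ν, X.g e y α ν * C y ν) (Γ y) (covA Γ (fun z => X.A e z 0) y) (C y)

/-- The coefficients of `∇ dx^μ` are scalar matrices, so their `(0, 0)` entries recover `Γ` and `C`.
Unlike an existential choice at each point, this yields fields on the whole chart. -/
lemma solution_of_pointQLC {ρ : M → ℂ} (hh : ∀ x, X.h x ≠ 0) (hρ0 : ∀ x, ρ x ≠ 0)
    (he : e ∈ charts n M) (hγ : X.HasInner (fun x => 1 + ρ x) (fun x => 1 - ρ x) ρ)
    (hA : ∀ y ∈ e.target, (∀ μ, X.A e y 1 μ = 0) ∧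
      (gTilde (X.g e y) (X.A e y 0) (X.h (e.symm y))).det ≠ 0)
    {y : E n} (hy : y ∈ e.target) {nn : Idx n → Idx n → Idx n → ℂ}
    {mm : Fin 2 → Fin 2 → Idx n → Idx n → ℂ}
    (H : PointQLC (X.G e y) (X.dG e y) (X.conn e y) nn mm) :
    ((∀ μ, pd μ (fun z => X.h (e.symm z)) y = 0) ∧
      X.PointSolutionAt e y (X.christoffel e) (X.cField e)) ∧
      nn = X.solutionNAt e y (X.christoffel e) (X.cField e) ∧
      mm = solutionM (X.A e y 0) (X.h (e.symm y)) (ρ (e.symm y)) := by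
  obtain ⟨h1, h2, h3⟩ := H
  have hin := fun k i j => hγ.coef he hy h1 k i j
  rw [G_eq (hA y hy).1, dG_eq (fun z hz => (hA z hz).1) hy] at h3
  have hn : ∀ μ b c, X.conn e y (Sum.inl μ) b c 0 0 = nn (Sum.inl μ) b c := by
    intro μ b c
    rw [h1]
    simp [connOf]
  obtain ⟨e1, e2, e3⟩ := QKK.solution_of_pointQLC (X.g_symm e he y hy) (hh _) (hρ0 _) (hA y hy).2
    h2 h3 (fun p k i j => (hin k i j).2 p) (fun k i j => (hin k i j).1)
    (Γ := X.christoffel e y) (nA := covA (X.christoffel e) (fun z => X.A e z 0) y)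
    (C := X.cField e y) (fun μ α β => by rw [christoffel, hn]) (fun α β => rfl)
    (fun μ => by rw [cField, hn])
  exact ⟨⟨congrFun e1, e2⟩, e3,
    eq_solutionM (hh _) (hρ0 _) h2 h3 fun p k i j => (hin k i j).2 p⟩

/-- Smoothness is inherited because `Γ` and `C` are matrix entries of the smooth connection
coefficients. -/
lemma isSolution_of_point {ρ : M → ℂ} (he : e ∈ charts n M)
    (H : ∀ y ∈ e.target, X.PointSolutionAt e y (X.christoffel e) (X.cField e) ∧
      X.conn e y = solutionConn (X.g e y) (X.A e y 0) (X.h (e.symm y)) (ρ (e.symm y))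
        (X.christoffel e y) (covA (X.christoffel e) (fun z => X.A e z 0) y) (X.cField e y)) :
    X.IsSolution ρ e (X.christoffel e) (X.cField e) where
  Γ_smooth _ _ _ := (X.conn_smooth e he _ _ _ 0 0).neg
  C_smooth _ := X.conn_smooth e he _ _ _ 0 0
  Γ_symm y hy := (H y hy).1.Γ_symm
  covariant y hy := (H y hy).1.covariant
  orthogonal y hy := (H y hy).1.orthogonal
  conn_eq y hy := (H y hy).2

lemma IsSolution.pointSolution {ρ : M → ℂ} {Γ : E n → Fin n → Fin n → Fin n → ℂ}
    {C : E n → Fin n → ℂ} (H : X.IsSolution ρ e Γ C) {y : E n} (hy : y ∈ e.target) :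
    X.PointSolutionAt e y Γ C :=
  ⟨H.Γ_symm y hy, H.covariant y hy, H.orthogonal y hy⟩

lemma IsSolution.pointQLC {ρ : M → ℂ} {Γ : E n → Fin n → Fin n → Fin n → ℂ}
    {C : E n → Fin n → ℂ} (H : X.IsSolution ρ e Γ C) (hh : ∀ x, X.h x ≠ 0) (hρ0 : ∀ x, ρ x ≠ 0)
    (he : e ∈ charts n M) (hA : ∀ y ∈ e.target, (∀ μ, X.A e y 1 μ = 0) ∧
      (gTilde (X.g e y) (X.A e y 0) (X.h (e.symm y))).det ≠ 0)
    (hloc : ∀ y ∈ e.target, ∀ μ, pd μ (fun z => X.h (e.symm z)) y = 0)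
    {y : E n} (hy : y ∈ e.target) :
    PointQLC (X.G e y) (X.dG e y) (X.conn e y) (X.solutionNAt e y Γ C)
      (solutionM (X.A e y 0) (X.h (e.symm y)) (ρ (e.symm y))) := by
  rw [G_eq (hA y hy).1, dG_eq (fun z hz => (hA z hz).1) hy, H.conn_eq y hy, funext (hloc y hy)]
  exact pointQLC_solution (X.g_symm e he y hy) (hh _) (hρ0 _) (hA y hy).2 (fun α β => rfl)
    (H.pointSolution hy)

lemma star_eq_self_iff_im {z : ℂ} : star z = z ↔ z.im = 0 := Complex.conj_eq_iff_im

lemma star_eq_neg_iff_re {z : ℂ} : star z = -z ↔ z.re = 0 := by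
  rw [Complex.ext_iff]
  simp [self_eq_neg]

lemma dagger_metric_iff (hA : ∀ y ∈ e.target, ∀ μ, X.A e y 1 μ = 0) (he : e ∈ charts n M) :
    (∀ y ∈ e.target, dagger (X.metric e) y = X.metric e y) ↔
      ∀ y ∈ e.target, ((∀ μ ν, star (X.g e y μ ν) = X.g e y μ ν) ∧
        (∀ μ, star (X.A e y 0 μ) = X.A e y 0 μ)) ∧ star (X.h (e.symm y)) = X.h (e.symm y) := by
  have key : ∀ y a b, dagger (X.metric e) y a b
      = star (metricCoef (X.g e y) (X.A e y) (X.h (e.symm y)) b a) • (1 : Mat) := by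
    intro y a b
    simp [dagger, metric]
  refine forall₂_congr fun y hy => ?_
  constructor
  · intro H
    have h : ∀ a b, _ := fun a b =>
      smul_one_inj.1 ((key y a b).symm.trans (congrFun (congrFun H a) b))
    refine ⟨⟨fun μ ν => ?_, fun μ => h (Sum.inl μ) (Sum.inr 0)⟩, ?_⟩
    · rw [X.g_symm e he y hy μ ν]
      exact (h (Sum.inl μ) (Sum.inl ν)).trans (X.g_symm e he y hy μ ν)
    · simpa [metricCoef] using h (Sum.inr 0) (Sum.inr 0)
  · rintro ⟨⟨h1, h2⟩, h3⟩
    have hA1 : ∀ i μ, star (X.A e y i μ) = X.A e y i μ := by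
      intro i μ
      fin_cases i
      · exact h2 μ
      · change star (X.A e y 1 μ) = X.A e y 1 μ
        rw [hA y hy, star_zero]
    funext a b
    rw [key, metricCoef_symm (X.g_symm e he y hy)]
    change _ = metricCoef (X.g e y) (X.A e y) (X.h (e.symm y)) a b • (1 : Mat)
    congr 1
    rcases a with μ | i <;> rcases b with ν | j
    · exact h1 μ ν
    · exact hA1 j μ
    · exact hA1 i ν
    · have h3' : (starRingEnd ℂ) (X.h (e.symm y)) = X.h (e.symm y) := h3
      fin_cases i <;> fin_cases j <;> simp [metricCoef, h3']

section SpecialCase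

variable [IsManifold (modelWithCornersSelf ℝ (E n)) ∞ M]

theorem isQLC_iff {ρ : M → ℂ} (hh : ∀ x, X.h x ≠ 0) (hρ0 : ∀ x, ρ x ≠ 0)
    (hγ : X.HasInner (fun x => 1 + ρ x) (fun x => 1 - ρ x) ρ)
    (hA : ∀ e ∈ charts n M, ∀ y ∈ e.target, (∀ μ, X.A e y 1 μ = 0) ∧
      (gTilde (X.g e y) (X.A e y 0) (X.h (e.symm y))).det ≠ 0) :
    X.IsQLC ↔ IsLocallyConstant X.h ∧ ∀ e ∈ charts n M, ∃ Γ C, X.IsSolution ρ e Γ C := by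
  rw [isLocallyConstant_iff_pd X.h_smooth]
  constructor
  · intro H
    refine ⟨fun e he y hy => ?_, fun e he => ⟨_, _, isSolution_of_point he fun y hy => ?_⟩⟩
    all_goals
      obtain ⟨nn, mm, h1⟩ := (exists_isQLC_iff he).1 (H e he).2 y hy
      obtain ⟨h2, h3, h4⟩ := solution_of_pointQLC hh hρ0 he hγ (hA e he) hy h1
    · exact h2.1
    · refine ⟨h2.2, ?_⟩
      rw [h1.conn, h3, h4, solutionConn_eq_connOf]
  · rintro ⟨hloc, H⟩ e he
    refine ⟨isQuantumMetric_special hh he (hA e he), (exists_isQLC_iff he).2 fun y hy => ?_⟩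
    obtain ⟨Γ, C, h1⟩ := H e he
    exact ⟨_, _, h1.pointQLC hh hρ0 he (hA e he) (hloc e he) hy⟩

theorem isStarQLC_iff {ρ : M → ℂ} (hh : ∀ x, X.h x ≠ 0) (hρ0 : ∀ x, ρ x ≠ 0)
    (hγ : X.HasInner (fun x => 1 + ρ x) (fun x => 1 - ρ x) ρ)
    (hA : ∀ e ∈ charts n M, ∀ y ∈ e.target, (∀ μ, X.A e y 1 μ = 0) ∧
      (gTilde (X.g e y) (X.A e y 0) (X.h (e.symm y))).det ≠ 0) :
    X.IsStarQLC ↔ IsLocallyConstant X.h ∧ (∀ x, (X.h x).im = 0) ∧ (∀ x, (ρ x).re = 0) ∧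
      ∀ e ∈ charts n M,
        (∀ y ∈ e.target, (∀ μ ν, (X.g e y μ ν).im = 0) ∧ (∀ μ, (X.A e y 0 μ).im = 0)) ∧
        ∃ Γ C, X.IsSolution ρ e Γ C ∧
          ∀ y ∈ e.target, (∀ μ α β, (Γ y μ α β).im = 0) ∧ (∀ μ, (C y μ).im = 0) := by
  simp only [← star_eq_self_iff_im, ← star_eq_neg_iff_re]
  constructor
  · intro H
    have hd := fun e he => (dagger_metric_iff (fun y hy => (hA e he y hy).1) he).1 (H e he).2.1
    have hs : ∀ e ∈ charts n M, ∀ y ∈ e.target,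
        X.PointSolutionAt e y (X.christoffel e) (X.cField e) ∧
        X.conn e y = solutionConn (X.g e y) (X.A e y 0) (X.h (e.symm y)) (ρ (e.symm y))
          (X.christoffel e y) (covA (X.christoffel e) (fun z => X.A e z 0) y) (X.cField e y) ∧
        (∀ μ α β, star (X.christoffel e y μ α β) = X.christoffel e y μ α β) ∧
        (∀ μ, star (X.cField e y μ) = X.cField e y μ) ∧
        star (ρ (e.symm y)) = -ρ (e.symm y) := by
      intro e he y hy
      obtain ⟨nn, mm, h1, h5⟩ := (exists_isStarQLC_iff he).1 (H e he).2.2 y hy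
      obtain ⟨h2, h3, h4⟩ := solution_of_pointQLC hh hρ0 he hγ (hA e he) hy h1
      have hconn := h1.conn
      subst h3 h4
      refine ⟨h2.2, ?_, real_of_starAt (hρ0 _) h5⟩
      rw [hconn, solutionConn_eq_connOf]
    have hx : ∀ x : M, x ∈ (chartAt (E n) x).source := mem_chart_source (E n)
    refine ⟨((isQLC_iff hh hρ0 hγ hA).1 H.isQLC).1, fun x => ?_, fun x => ?_, fun e he =>
      ⟨fun y hy => (hd e he y hy).1, _, _, isSolution_of_point he fun y hy =>
        ⟨(hs e he y hy).1, (hs e he y hy).2.1⟩,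
        fun y hy => ⟨(hs e he y hy).2.2.1, (hs e he y hy).2.2.2.1⟩⟩⟩
    · have := (hd _ (IsManifold.chart_mem_maximalAtlas x) _
        ((chartAt (E n) x).map_source (hx x))).2
      rwa [(chartAt (E n) x).left_inv (hx x)] at this
    · have := (hs _ (IsManifold.chart_mem_maximalAtlas x) _
        ((chartAt (E n) x).map_source (hx x))).2.2.2.2
      rwa [(chartAt (E n) x).left_inv (hx x)] at this
  · rintro ⟨hloc, hhr, hρr, H⟩ e he
    rw [isLocallyConstant_iff_pd X.h_smooth] at hloc
    obtain ⟨h1, Γ, C, h2, h3⟩ := H e he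
    refine ⟨isQuantumMetric_special hh he (hA e he),
      (dagger_metric_iff (fun y hy => (hA e he y hy).1) he).2 fun y hy => ⟨h1 y hy, hhr _⟩,
      (exists_isStarQLC_iff he).2 fun y hy =>
        ⟨_, _, h2.pointQLC hh hρ0 he (hA e he) (hloc e he) hy,
          starAt_solution (hρ0 _) (hA e he y hy).2 (h1 y hy).1 (h1 y hy).2 (hhr _) (hρr _)
            (h3 y hy).1 (fun α β => ?_) (h3 y hy).2⟩⟩
    -- The remaining condition is reality of `∇_α A_β`, which needs `A` real on a neighbourhood and
    -- not only at the point.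
    simp only [covA, star_sub, star_sum, star_mul', (h3 y hy).1, (h1 y hy).2]
    rw [star_pd_of_real e.open_target (fun z hz => (h1 z hz).2 β) hy]

end SpecialCase

end Geometry

end QKK

end

theorem mainTheorem2 {n : ℕ} {M : Type*} [TopologicalSpace M]
    [ChartedSpace (QKK.E n) M] [IsManifold (modelWithCornersSelf ℝ (QKK.E n)) ∞ M]
    (X : QKK.Geometry n M) (hh : ∀ x, X.h x ≠ 0)
    (u v ρ : M → ℂ)
    (hu : ContMDiff (modelWithCornersSelf ℝ (QKK.E n)) (modelWithCornersSelf ℝ ℂ) ∞ u)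
    (hv : ContMDiff (modelWithCornersSelf ℝ (QKK.E n)) (modelWithCornersSelf ℝ ℂ) ∞ v)
    (hρ : ContMDiff (modelWithCornersSelf ℝ (QKK.E n)) (modelWithCornersSelf ℝ ℂ) ∞ ρ)
    (hρ0 : ∀ x, ρ x ≠ 0)
    (hγ : X.HasInner u v ρ) :
    -- the two cases, at every point of `M`
    (X.IsQLC → ∀ e ∈ QKK.charts n M, ∀ x ∈ e.source,
      (∀ i μ, X.A e (e x) i μ = 0) ∨
      ((∀ μ, (v x + ρ x - 1) * X.A e (e x) 0 μ
          = Complex.I * (v x - ρ x - 1) * X.A e (e x) 1 μ) ∧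
        (u x - 1) * (v x - 1) = -(ρ x) ^ 2)) ∧
    -- the two cases, globally, for constant parameters
    (X.IsQLC → (∀ x x', u x = u x' ∧ v x = v x' ∧ ρ x = ρ x') →
      (∀ e ∈ QKK.charts n M, ∀ x ∈ e.source, ∀ i μ, X.A e (e x) i μ = 0) ∨
      ((∀ e ∈ QKK.charts n M, ∀ x ∈ e.source, ∀ μ, (v x + ρ x - 1) * X.A e (e x) 0 μ
          = Complex.I * (v x - ρ x - 1) * X.A e (e x) 1 μ) ∧
        ∀ x, (u x - 1) * (v x - 1) = -(ρ x) ^ 2)) ∧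
    -- the first case occurs without any restriction on the parameters
    (IsLocallyConstant X.h →
      (∀ e ∈ QKK.charts n M, ∀ y ∈ e.target,
        (∀ i μ, X.A e y i μ = 0) ∧ (Matrix.of (X.g e y)).det ≠ 0) →
      (∀ e ∈ QKK.charts n M, ∃ Γ : QKK.E n → Fin n → Fin n → Fin n → ℂ,
        ∀ y ∈ e.target, (∀ μ α β, Γ y μ α β = Γ y μ β α) ∧
          (∀ α β ν, QKK.covG Γ (X.g e) y α β ν = 0) ∧
          X.conn e y = QKK.directSumConn (Γ y)
            (QKK.gamma (u (e.symm y)) (v (e.symm y)) (ρ (e.symm y)))) →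
      X.IsQLC) ∧
    -- the simplest instance of the second case
    ((∀ x, u x = 1 + ρ x ∧ v x = 1 - ρ x) →
      (∀ e ∈ QKK.charts n M, ∀ y ∈ e.target, (∀ μ, X.A e y 1 μ = 0) ∧
        (QKK.gTilde (X.g e y) (X.A e y 0) (X.h (e.symm y))).det ≠ 0) →
      (X.IsQLC ↔ IsLocallyConstant X.h ∧
        ∀ e ∈ QKK.charts n M, ∃ Γ C, X.IsSolution ρ e Γ C) ∧
      (X.IsStarQLC ↔ IsLocallyConstant X.h ∧ (∀ x, (X.h x).im = 0) ∧ (∀ x, (ρ x).re = 0) ∧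
        ∀ e ∈ QKK.charts n M,
          (∀ y ∈ e.target, (∀ μ ν, (X.g e y μ ν).im = 0) ∧ (∀ μ, (X.A e y 0 μ).im = 0)) ∧
          ∃ Γ C, X.IsSolution ρ e Γ C ∧
            ∀ y ∈ e.target, (∀ μ α β, (Γ y μ α β).im = 0) ∧ (∀ μ, (C y μ).im = 0)) ∧
      (X.IsStarQLC → PreconnectedSpace M → ∃ c : ℝ, ∀ x, X.h x = c) ∧
      (∀ x, (∀ f, QKK.finLaplacian (X.h x) (QKK.gamma (u x) (v x) (ρ x)) f = 0) ∧
        QKK.finScalar (X.h x) (QKK.gamma (u x) (v x) (ρ x))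
          = (2 * ρ x ^ 2 / X.h x) • (1 : QKK.Mat))) := by
  refine ⟨fun H e he x hx => H.two_cases hρ0 hγ he hx, fun H hc => ?_, fun hloc hA hΓ =>
    QKK.Geometry.isQLC_of_directSum hh hρ0 hloc hA hΓ, fun huv hA => ?_⟩
  -- For constant parameters the quadratic relation holds everywhere or nowhere. If it holds, points
  -- with `A = 0` satisfy the linear relation trivially; if not, the second case is excluded at
  -- every point.
  · by_cases hQ : ∀ x, (u x - 1) * (v x - 1) = -(ρ x) ^ 2
    · refine Or.inr ⟨fun e he x hx μ => ?_, hQ⟩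
      rcases H.two_cases hρ0 hγ he hx with h | h
      · rw [h, h, mul_zero, mul_zero]
      · exact h.1 μ
    · refine Or.inl fun e he x hx => ?_
      rcases H.two_cases hρ0 hγ he hx with h | h
      · exact h
      · refine absurd (fun x' => ?_) hQ
        obtain ⟨h1, h2, h3⟩ := hc x' x
        rw [h1, h2, h3]
        exact h.2
  · obtain rfl : u = fun x => 1 + ρ x := funext fun x => (huv x).1
    obtain rfl : v = fun x => 1 - ρ x := funext fun x => (huv x).2
    have hstar := QKK.Geometry.isStarQLC_iff hh hρ0 hγ hA
    refine ⟨QKK.Geometry.isQLC_iff hh hρ0 hγ hA, hstar, fun H _ => ?_, fun x =>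
      ⟨QKK.finLaplacian_special (hρ0 x) _, QKK.finScalar_special (hρ0 x) (hh x)⟩⟩
    obtain ⟨hloc, him, -⟩ := hstar.1 H
    rcases isEmpty_or_nonempty M with hM | ⟨⟨x₀⟩⟩
    -- `PreconnectedSpace` allows an empty `M`, where any constant serves.
    · exact ⟨0, fun x => (hM.false x).elim⟩
    · refine ⟨(X.h x₀).re, fun x => ?_⟩
      rw [hloc.apply_eq_of_preconnectedSpace x x₀]
      exact Complex.ext (by simp) (by simp [him x₀])
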